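/- For $s,t,u,v\in\mathbb{C}$ let $$p=z\prod_{j=0}^{4}\Bigl(\cos\tfrac{2\pi j}{5}\,x+\sin\tfrac{2\pi j}{5}\,y-z\Bigr),\qquad q_{s,t,u,v}=s(x^2+y^2)+tz^2+uzw+vw^2,$$ $$f_{s,t,u,v}=p-q_{s,t,u,v}^3,\qquad f_{s,t,u}=f_{s,t,u,1},$$ and regard these forms of degree $6$ as surfaces in $\mathbb{P}^3=\mathbb{P}^3(\mathbb{C})$ with coordinates $(x:y:z:w)$. A singularity is of type $A_k$ if in suitable local holomorphic coordinates the surface has the equation $\xi_0^{k+1}+\xi_1^2+\xi_2^2=0$. Theorem 2. Let $s_0=\frac{1}{12}\sqrt[3]{5}\in\mathbb{R}$ and $t_0=4s_0$. Then the sextic $f_{s_0,t_0,0}$ has exactly $30$ singularities of type $A_2$, exactly $10$ singularities of type $A_1$, and no other singularities. Furthermore, after the change of coordinates $w\mapsto iw$, all the singularities are real: the real sextic $$f_{s_0,t_0,0}(x,y,z,iw)=f_{s_0,t_0,0,-1}(x,y,z,w)$$ also has exactly $30$ singularities of type $A_2$, exactly $10$ of type $A_1$ and no others, and all of its singular points lie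 in $\mathbb{P}^3(\mathbb{R})$. -/

import Mathlib

open MvPolynomial Topology
open scoped LinearAlgebra.Projectivization

noncomputable section

namespace CuspSextic

/-- Complex projective three-space, with homogeneous coordinates `(x : y : z : w)` indexed by
`0, 1, 2, 3`. -/
abbrev P3 : Type := ℙ ℂ (Fin 4 → ℂ)

/-- The product of the plane `z` and the five planes `cos (2πj/5) x + sin (2πj/5) y - z`. -/
def planes : MvPolynomial (Fin 4) ℂ :=
  X 2 * ∏ j ∈ Finset.range 5,
    (C ((Real.cos (2 * Real.pi * j / 5) : ℝ) : ℂ) * X 0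
      + C ((Real.sin (2 * Real.pi * j / 5) : ℝ) : ℂ) * X 1 - X 2)

/-- The quadric `s (x² + y²) + t z² + u z w + v w²`. -/
def quadric (s t u v : ℂ) : MvPolynomial (Fin 4) ℂ :=
  C s * (X 0 ^ 2 + X 1 ^ 2) + C t * X 2 ^ 2 + C u * (X 2 * X 3) + C v * X 3 ^ 2

/-- The sextic form `f_{s,t,u,v} = p - q_{s,t,u,v}³`. -/
def sextic (s t u v : ℂ) : MvPolynomial (Fin 4) ℂ :=
  planes - quadric s t u v ^ 3

/-- The member `f_{s,t,u} = f_{s,t,u,1}` of the normalized family. -/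
def sextic₁ (s t u : ℂ) : MvPolynomial (Fin 4) ℂ :=
  sextic s t u 1

/-- The substitution `F(x, y, z, w) ↦ F(x, y, z, lam * w)`. -/
def scaleW (lam : ℂ) (F : MvPolynomial (Fin 4) ℂ) : MvPolynomial (Fin 4) ℂ :=
  bind₁ ![X 0, X 1, X 2, C lam * X 3] F

/-- The singular points of the projective surface `F = 0`, for a homogeneous form `F`: the points
at which `F` and all its partial derivatives vanish (for a form this does not depend on the
representative of the point). -/
def singularPoints (F : MvPolynomial (Fin 4) ℂ) : Set P3 :=
  {P | eval P.rep F = 0 ∧ ∀ i, eval P.rep (pderiv i F) = 0}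

theorem insertNth_one_ne_zero (j : Fin 4) (a : Fin 3 → ℂ) :
    (j.insertNth (1 : ℂ) a : Fin 4 → ℂ) ≠ 0 := fun h => by
  have := congrFun h j
  simp at this

/-- The point of `P3` with affine coordinates `a` in the standard chart in which the `j`-th
homogeneous coordinate is `1`. -/
def affinePoint (j : Fin 4) (a : Fin 3 → ℂ) : P3 :=
  Projectivization.mk ℂ (j.insertNth (1 : ℂ) a : Fin 4 → ℂ) (insertNth_one_ne_zero j a)

/-- The germ at `a` of the hypersurface `g = 0` in `ℂ³` is an `A_k` singularity: in suitable local
holomorphic coordinates `ξ` centred at `a` it has the equation `ξ₀ ^ (k + 1) + ξ₁ ^ 2 + ξ₂ ^ 2 = 0`,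
that is, `g` is this expression up to a holomorphic unit. -/
def IsAGerm (k : ℕ) (g : (Fin 3 → ℂ) → ℂ) (a : Fin 3 → ℂ) : Prop :=
  ∃ (ξ : Fin 3 → (Fin 3 → ℂ) → ℂ) (unit : (Fin 3 → ℂ) → ℂ),
    (∀ i, AnalyticAt ℂ (ξ i) a) ∧ (∀ i, ξ i a = 0) ∧
    LinearIndependent ℂ (fun i => fderiv ℂ (ξ i) a) ∧
    AnalyticAt ℂ unit a ∧ unit a ≠ 0 ∧
    ∀ᶠ y in 𝓝 a, g y = unit y * (ξ 0 y ^ (k + 1) + ξ 1 y ^ 2 + ξ 2 y ^ 2)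

/-- The surface `F = 0` has at `P` a singularity of type `A_k`, seen in a standard affine chart
around `P`. -/
def IsASingularity (k : ℕ) (F : MvPolynomial (Fin 4) ℂ) (P : P3) : Prop :=
  ∃ (j : Fin 4) (a : Fin 3 → ℂ), P = affinePoint j a ∧
    IsAGerm k (fun y => eval (j.insertNth (1 : ℂ) y : Fin 4 → ℂ) F) a

/-- The surface `F = 0` has exactly `m` singularities of type `A_2`, exactly `n` of type `A_1`,
and no other singularities. -/
def HasExactlyCuspsNodes (F : MvPolynomial (Fin 4) ℂ) (m n : ℕ) : Prop :=
  {P ∈ singularPoints F | IsASingularity 2 F P}.Finite ∧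
  {P ∈ singularPoints F | IsASingularity 2 F P}.ncard = m ∧
  {P ∈ singularPoints F | IsASingularity 1 F P}.Finite ∧
  {P ∈ singularPoints F | IsASingularity 1 F P}.ncard = n ∧
  ∀ P ∈ singularPoints F, IsASingularity 2 F P ∨ IsASingularity 1 F P

/-- A point of `P3` is real if it has real homogeneous coordinates. -/
def IsRealPoint (P : P3) : Prop :=
  ∃ (c : Fin 4 → ℝ) (h : (fun i => (c i : ℂ)) ≠ 0),
    P = Projectivization.mk ℂ (fun i => (c i : ℂ)) h

end CuspSextic

end

namespace CuspSextic

open Filter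

/-! The six planes meet pairwise in fifteen lines, along which `p` looks locally like a product of
two coordinates. Where the quadric `q` meets such a line transversally, `p - q³` is therefore a
cusp, and two points on each of the fifteen lines give thirty cusps.

The `w`-derivative is a multiple of `v w q²`, so a singular point with `q ≠ 0` lies in the plane `w
= 0`; it also has `z ≠ 0`, since `p` vanishes on `z = 0`. For `z ≠ 0` the derivative of the sextic
along rotations about the axis `x = y = 0` is a multiple of `z · Im (x + i y)^5`, so up to one of
the five rotations `y = 0`. With `t = 4 s` and `s³ = 5/1728` the sextic restricted to `y = w = 0` is
`-(x² - 12xz + 16z²)² (5x² + 12xz + 8z²) / 1728`. Its two double roots, rotated, are the ten nodes.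

`IsSing.classify` carries out this analysis. The three `isAGerm` lemmas for fifth turns write the
equation as a combination of transversal functions with unit coefficients, which `isAGerm_of_units`
turns into a normal form. Exact counts also need that no point is of both types:
`IsASingularity.not_cusp_of_node` compares ranks of leading quadratic forms. Both real structures
are handled together through a number `ω` with `v ω² = -1`. -/

/-! ### Recognising `A_k` germs. -/

theorem linearIndependent_of_det_ne_zero {E : Type*} [NormedAddCommGroup E] [NormedSpace ℂ E]
    {φ : Fin 3 → (E →L[ℂ] ℂ)} (v : Fin 3 → E)
    (h : (Matrix.of fun i j => φ i (v j)).det ≠ 0) : LinearIndependent ℂ φ := by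
  rw [Fintype.linearIndependent_iff]
  intro c hc
  have : Matrix.vecMul c (Matrix.of fun i j => φ i (v j)) = 0 := by
    ext j
    have := congrArg (fun ψ : E →L[ℂ] ℂ => ψ (v j)) hc
    simpa [Matrix.vecMul, dotProduct] using this
  exact fun i => congrFun (Matrix.eq_zero_of_vecMul_eq_zero h this) i

/-- A nonvanishing analytic germ has an analytic square root. -/
theorem exists_analyticAt_sq_eq {E : Type*} [NormedAddCommGroup E] [NormedSpace ℂ E]
    {U : E → ℂ} {a : E} (hU : AnalyticAt ℂ U a) (h0 : U a ≠ 0) :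
    ∃ R : E → ℂ, AnalyticAt ℂ R a ∧ R a ≠ 0 ∧ ∀ᶠ y in 𝓝 a, R y ^ 2 = U y := by
  obtain ⟨r, hr⟩ := IsAlgClosed.exists_pow_nat_eq (U a) two_pos
  have hr0 : r ≠ 0 := by rintro rfl; simp_all
  -- Dividing by `U a` makes the base equal to 1 at `a`, safely inside the slit plane where the
  -- principal power is analytic.
  refine ⟨fun y => r * (U y / U a) ^ (2⁻¹ : ℂ), ?_, ?_, ?_⟩
  · refine analyticAt_const.mul (AnalyticAt.cpow (hU.div analyticAt_const h0) analyticAt_const ?_)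
    simp [h0]
  · simp [h0, hr0]
  · refine Eventually.of_forall fun y => ?_
    have : ((U y / U a) ^ (2⁻¹ : ℂ)) ^ 2 = U y / U a := by
      exact_mod_cast Complex.cpow_nat_inv_pow (U y / U a) (n := 2) two_ne_zero
    rw [mul_pow, this, hr]
    field_simp

theorem hasFDerivAt_mul_of_eq_zero {E : Type*} [NormedAddCommGroup E] [NormedSpace ℂ E]
    {R L : E → ℂ} {a : E} {L' : E →L[ℂ] ℂ} (hR : AnalyticAt ℂ R a) (hL : HasFDerivAt L L' a)
    (h0 : L a = 0) : HasFDerivAt (fun y => R y * L y) (R a • L') a := by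
  have := hR.differentiableAt.hasFDerivAt.mul hL
  refine this.congr_fderiv ?_
  ext v
  simp [h0]

/-- Absorbing units into the coordinates: a germ `unit * (ξ ^ (k+1) + U₁ L₁ ^ 2 + U₂ L₂ ^ 2)` with
transversal `ξ`, `L₁`, `L₂` is an `A_k` singularity. -/
theorem isAGerm_of_units {k : ℕ} {g : (Fin 3 → ℂ) → ℂ} {a : Fin 3 → ℂ}
    (ξ L₁ L₂ unit U₁ U₂ : (Fin 3 → ℂ) → ℂ) {ξ' L₁' L₂' : (Fin 3 → ℂ) →L[ℂ] ℂ}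
    (hξ : AnalyticAt ℂ ξ a) (h₁ : AnalyticAt ℂ L₁ a) (h₂ : AnalyticAt ℂ L₂ a)
    (hu : AnalyticAt ℂ unit a) (hU₁ : AnalyticAt ℂ U₁ a) (hU₂ : AnalyticAt ℂ U₂ a)
    (u0 : unit a ≠ 0) (U₁0 : U₁ a ≠ 0) (U₂0 : U₂ a ≠ 0)
    (ξ0 : ξ a = 0) (L₁0 : L₁ a = 0) (L₂0 : L₂ a = 0)
    (dξ : HasFDerivAt ξ ξ' a) (dL₁ : HasFDerivAt L₁ L₁' a) (dL₂ : HasFDerivAt L₂ L₂' a)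
    (v : Fin 3 → Fin 3 → ℂ)
    (hdet : (Matrix.of fun i j => (![ξ', L₁', L₂'] i) (v j)).det ≠ 0)
    (hg : ∀ᶠ y in 𝓝 a, g y = unit y * (ξ y ^ (k + 1) + U₁ y * L₁ y ^ 2 + U₂ y * L₂ y ^ 2)) :
    IsAGerm k g a := by
  obtain ⟨R₁, hR₁, R₁0, hs₁⟩ := exists_analyticAt_sq_eq hU₁ U₁0
  obtain ⟨R₂, hR₂, R₂0, hs₂⟩ := exists_analyticAt_sq_eq hU₂ U₂0
  refine ⟨![ξ, fun y => R₁ y * L₁ y, fun y => R₂ y * L₂ y], unit, ?_, ?_, ?_, hu, u0, ?_⟩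
  · intro i
    fin_cases i
    · exact hξ
    · exact hR₁.mul h₁
    · exact hR₂.mul h₂
  · intro i
    fin_cases i <;> simp [ξ0, L₁0, L₂0]
  · refine linearIndependent_of_det_ne_zero v ?_
    have e₁ := (hasFDerivAt_mul_of_eq_zero hR₁ dL₁ L₁0).fderiv
    have e₂ := (hasFDerivAt_mul_of_eq_zero hR₂ dL₂ L₂0).fderiv
    rw [Matrix.det_fin_three] at hdet ⊢
    simp only [Matrix.of_apply, Matrix.cons_val] at hdet ⊢
    rw [dξ.fderiv, e₁, e₂]
    simp only [smul_apply, smul_eq_mul]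
    -- Multiplying `L₁`, `L₂` by the square roots scales two rows of the Jacobian by `R₁ a` and `R₂
    -- a`.
    refine fun h => hdet ?_
    have : R₁ a * R₂ a ≠ 0 := mul_ne_zero R₁0 R₂0
    refine (mul_eq_zero.1 ?_).resolve_left this
    linear_combination h
  · filter_upwards [hg, hs₁, hs₂] with y hy h1 h2
    simp only [Matrix.cons_val]
    rw [hy, mul_pow, mul_pow, h1, h2]

/-! ### Nodes and cusps are distinct: ranks of leading quadratic forms. -/

/-- The leading quadratic form of an `A_k` germ. -/
theorem IsAGerm.exists_tendsto {k : ℕ} (hk : 1 ≤ k) {g : (Fin 3 → ℂ) → ℂ} {a : Fin 3 → ℂ}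
    (h : IsAGerm k g a) :
    ∃ (c : ℂ) (φ : Fin 3 → (Fin 3 → ℂ) →L[ℂ] ℂ), c ≠ 0 ∧ LinearIndependent ℂ φ ∧
      ∀ u, Tendsto (fun ρ : ℂ => g (a + ρ • u) / ρ ^ 2) (𝓝[≠] 0)
        (𝓝 (c * (φ 0 u ^ 2 * 0 ^ (k - 1) + φ 1 u ^ 2 + φ 2 u ^ 2))) := by
  obtain ⟨ξ, unit, hξ, ξ0, hli, hu, u0, hg⟩ := h
  refine ⟨unit a, fun i => fderiv ℂ (ξ i) a, u0, hli, fun u => ?_⟩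
  have hline : Tendsto (fun ρ : ℂ => a + ρ • u) (𝓝[≠] 0) (𝓝 a) := by
    have : Continuous (fun ρ : ℂ => a + ρ • u) := by fun_prop
    simpa using (this.tendsto 0).mono_left nhdsWithin_le_nhds
  have hslope : ∀ i, Tendsto (fun ρ : ℂ => ξ i (a + ρ • u) / ρ) (𝓝[≠] 0)
      (𝓝 (fderiv ℂ (ξ i) a u)) := fun i => by
    have := ((hξ i).differentiableAt.hasFDerivAt.hasLineDerivAt u)
    have := this.tendsto_slope_zero
    simpa [ξ0, div_eq_inv_mul] using this
  have h0 : Tendsto (fun ρ : ℂ => ξ 0 (a + ρ • u)) (𝓝[≠] 0) (𝓝 0) := by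
    have := (hξ 0).continuousAt.tendsto.comp hline
    rwa [ξ0] at this
  -- Split `ξ₀^(k+1) / ρ²` as `(ξ₀/ρ)² · ξ₀^(k-1)`. The last factor tends to `0^(k-1)`, which is 1
  -- for `k = 1` and 0 for larger `k`: the form has rank 3 or 2.
  have hlim := (hu.continuousAt.tendsto.comp hline).mul
    (((((hslope 0).pow 2).mul (h0.pow (k - 1))).add ((hslope 1).pow 2)).add ((hslope 2).pow 2))
  refine hlim.congr' ?_
  filter_upwards [hline.eventually hg, self_mem_nhdsWithin] with ρ hρ hne
  have hne : ρ ≠ 0 := hne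
  obtain ⟨m, rfl⟩ : ∃ m, k = m + 1 := ⟨k - 1, by omega⟩
  simp only [Function.comp, hρ, Nat.add_sub_cancel]
  field_simp
  ring

theorem eval_smul_of_isHomogeneous {F : MvPolynomial (Fin 4) ℂ} {d : ℕ} (hF : F.IsHomogeneous d)
    (c : ℂ) (x : Fin 4 → ℂ) : eval (c • x) F = c ^ d * eval x F := by
  simp only [eval_eq', Finset.mul_sum]
  refine Finset.sum_congr rfl fun e he => ?_
  have hdeg : e.degree = d := by
    by_contra h
    exact mem_support_iff.1 he (hF.coeff_eq_zero h)
  simp only [Pi.smul_apply, smul_eq_mul, mul_pow, Finset.prod_mul_distrib,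
    Finset.prod_pow_eq_pow_sum]
  rw [← Finsupp.degree_eq_sum, hdeg]
  ring

/-- The leading quadratic form of a form `F` at a singular point of type `A_k`. -/
theorem IsASingularity.exists_tendsto {k : ℕ} (hk : 1 ≤ k) {F : MvPolynomial (Fin 4) ℂ}
    (hF : F.IsHomogeneous 6) {v : Fin 4 → ℂ} {hv : v ≠ 0}
    (h : IsASingularity k F (Projectivization.mk ℂ v hv)) :
    ∃ (c : ℂ) (φ : Fin 3 → (Fin 3 → ℂ) →L[ℂ] ℂ) (j : Fin 4) (a : Fin 3 → ℂ) (m : ℂ), c ≠ 0 ∧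
      LinearIndependent ℂ φ ∧ m ≠ 0 ∧ v = m • (j.insertNth 1 a : Fin 4 → ℂ) ∧
      ∀ u : Fin 4 → ℂ, Tendsto (fun ρ : ℂ => eval (v + ρ • u) F / ρ ^ 2) (𝓝[≠] 0)
        (𝓝 (c * (φ 0 (j.removeNth u - u j • a) ^ 2 * 0 ^ (k - 1)
          + φ 1 (j.removeNth u - u j • a) ^ 2 + φ 2 (j.removeNth u - u j • a) ^ 2))) := by
  obtain ⟨j, a, hP, hg⟩ := h
  obtain ⟨c, φ, hc, hli, hlim⟩ := hg.exists_tendsto hk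
  obtain ⟨m, hm⟩ := (Projectivization.mk_eq_mk_iff' ℂ _ _ _ _).1 hP
  have hm0 : m ≠ 0 := by rintro rfl; simp at hm; exact hv hm.symm
  -- Degree 6 contributes `m^6`; the chart parameter `ρ / (m + ρ u_j)` costs `m^2`.
  refine ⟨m ^ 4 * c, φ, j, a, m, by positivity, hli, hm0, hm.symm, fun u => ?_⟩
  set u' := j.removeNth u - u j • a with hu'
  have hM : Tendsto (fun ρ : ℂ => m + ρ * u j) (𝓝[≠] 0) (𝓝 m) := by
    have : Continuous (fun ρ : ℂ => m + ρ * u j) := by fun_prop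
    simpa using (this.tendsto 0).mono_left nhdsWithin_le_nhds
  have hMne : ∀ᶠ ρ in 𝓝[≠] (0 : ℂ), m + ρ * u j ≠ 0 := hM.eventually_ne hm0
  have hρ : Tendsto (fun ρ : ℂ => ρ / (m + ρ * u j)) (𝓝[≠] 0) (𝓝[≠] 0) := by
    refine tendsto_nhdsWithin_iff.2 ⟨?_, ?_⟩
    · have : Tendsto (fun ρ : ℂ => ρ) (𝓝[≠] 0) (𝓝 0) := nhdsWithin_le_nhds
      have := this.div hM hm0
      rw [zero_div] at this
      exact this
    · filter_upwards [hMne, self_mem_nhdsWithin] with ρ h1 h2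
      exact div_ne_zero h2 h1
  have := (hM.pow 4).mul ((hlim u').comp hρ)
  rw [mul_assoc]
  refine this.congr' ?_
  filter_upwards [hMne, self_mem_nhdsWithin] with ρ h1 h2
  have h2 : ρ ≠ 0 := h2
  have key : v + ρ • u = (m + ρ * u j) •
      (j.insertNth 1 (a + (ρ / (m + ρ * u j)) • u') : Fin 4 → ℂ) := by
    rw [← hm]
    ext i
    refine Fin.succAboveCases j ?_ (fun i => ?_) i
    · simp
    · simp [hu', Fin.removeNth]
      field_simp
      ring
  simp only [Function.comp]
  rw [key, eval_smul_of_isHomogeneous hF]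
  field_simp

theorem eq_zero_of_linearIndependent {φ : Fin 3 → (Fin 3 → ℂ) →L[ℂ] ℂ}
    (h : LinearIndependent ℂ φ) {u : Fin 3 → ℂ} (hu : ∀ i, φ i u = 0) : u = 0 := by
  by_contra hne
  have hM : (Matrix.of fun i j => φ i (Pi.single j 1)).det = 0 := by
    refine Matrix.exists_mulVec_eq_zero_iff.1 ⟨u, hne, ?_⟩
    ext i
    have : u = ∑ j, u j • (Pi.single j 1 : Fin 3 → ℂ) := by
      simpa using (Pi.basisFun ℂ (Fin 3)).sum_repr u |>.symm
    have h1 := hu i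
    rw [this, map_sum] at h1
    simpa [Matrix.mulVec, dotProduct, mul_comm] using h1
  obtain ⟨c, hc, hc0⟩ := Matrix.exists_vecMul_eq_zero_iff.2 hM
  refine hc (funext (Fintype.linearIndependent_iff.1 h c ?_))
  refine ContinuousLinearMap.coe_inj.1 ((Pi.basisFun ℂ (Fin 3)).ext fun j => ?_)
  simpa [Matrix.vecMul, dotProduct] using congrFun hc0 j

/-- A point of a sextic surface is not both a node and a cusp. -/
theorem IsASingularity.not_cusp_of_node {F : MvPolynomial (Fin 4) ℂ} (hF : F.IsHomogeneous 6)
    {P : P3} (h1 : IsASingularity 1 F P) (h2 : IsASingularity 2 F P) : False := by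
  induction P using Projectivization.ind with | h v hv => ?_
  obtain ⟨c, φ, j, a, m, hc, hli, hm, hva, hlim⟩ := h1.exists_tendsto le_rfl hF
  obtain ⟨d, ψ, l, b, n, hd, hli', hn, hvb, hlim'⟩ := h2.exists_tendsto (by norm_num) hF
  simp only [Nat.sub_self, pow_zero, mul_one] at hlim
  simp only [show 2 - 1 = 1 from rfl, pow_one, mul_zero, zero_add] at hlim'
  have huniq := fun u => tendsto_nhds_unique (hlim u) (hlim' u)
  -- The cusp form only involves two linear forms, so its radical contains a nonzero tangent
  -- direction in the chart `l`. Transported to the node form, whose radical on `ℂ⁴` is only the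
  -- line of `v`, this direction is a multiple of `v`; but its `l`-coordinate is 0 and that of `v`
  -- is not.
  obtain ⟨w, hw, hw0⟩ : ∃ w : Fin 3 → ℂ, (∀ i : Fin 2, ψ i.succ w = 0) ∧ w ≠ 0 := by
    have hk : LinearMap.ker (LinearMap.pi fun i : Fin 2 =>
        (ψ i.succ : (Fin 3 → ℂ) →ₗ[ℂ] ℂ)) ≠ ⊥ :=
      LinearMap.ker_ne_bot_of_finrank_lt (by simp)
    obtain ⟨w, hw, hw0⟩ := Submodule.exists_mem_ne_zero_of_ne_bot hk
    exact ⟨w, fun i => congrFun (LinearMap.mem_ker.1 hw) i, hw0⟩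
  have hw1 : ψ 1 w = 0 := hw 0
  have hw2 : ψ 2 w = 0 := hw 1
  set e : Fin 4 → ℂ := l.insertNth 0 w with he
  have hel : e l = 0 := by simp [he]
  have her : l.removeNth e = w := by simp [he]
  set T : (Fin 4 → ℂ) → (Fin 3 → ℂ) := fun u => j.removeNth u - u j • a with hT
  have hTadd : ∀ u u', T (u + u') = T u + T u' := fun u u' => by
    ext i; simp [hT, Fin.removeNth]; ring
  have hinv : ∀ u, φ 0 (T (u + e)) ^ 2 + φ 1 (T (u + e)) ^ 2 + φ 2 (T (u + e)) ^ 2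
      = φ 0 (T u) ^ 2 + φ 1 (T u) ^ 2 + φ 2 (T u) ^ 2 := fun u => by
    refine mul_left_cancel₀ hc ?_
    rw [huniq u, huniq (u + e)]
    have : l.removeNth (u + e) - (u + e) l • b = (l.removeNth u - u l • b) + w := by
      rw [← her]
      ext i
      simp [hel, Fin.removeNth]
      ring
    rw [this]
    simp [hw1, hw2]
  have h0 : φ 0 (T e) ^ 2 + φ 1 (T e) ^ 2 + φ 2 (T e) ^ 2 = 0 := by
    have := hinv 0
    have hT0 : T 0 = 0 := by ext i; simp [hT, Fin.removeNth]
    simpa [hT0] using this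
  -- Polarisation of the invariance under translation by `e`.
  have hort : ∀ x : Fin 3 → ℂ, φ 0 (T e) * φ 0 x + φ 1 (T e) * φ 1 x + φ 2 (T e) * φ 2 x = 0 := by
    intro x
    have hx : T (j.insertNth 0 x) = x := by simp [hT]
    have := hinv (j.insertNth 0 x)
    rw [hTadd, hx] at this
    simp only [map_add] at this
    linear_combination this / 2 - h0 / 2
  have hTe : T e = 0 := by
    refine eq_zero_of_linearIndependent hli (Fintype.linearIndependent_iff.1 hli _ ?_)
    ext x
    simpa [Fin.sum_univ_three] using hort x
  have hprop : e = e j • (j.insertNth 1 a : Fin 4 → ℂ) := by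
    ext i
    refine Fin.succAboveCases j ?_ (fun i => ?_) i
    · simp
    · have := congrFun hTe i
      simp [hT, Fin.removeNth] at this ⊢
      linear_combination this
  have hej : e j ≠ 0 := by
    intro h
    rw [h, zero_smul] at hprop
    exact hw0 (by rw [← her, hprop]; rfl)
  have hvl : v l = n := by rw [hvb]; simp
  have : n = m * (j.insertNth 1 a : Fin 4 → ℂ) l := by rw [← hvl, hva]; simp
  have h3 := congrFun hprop l
  simp only [hel, Pi.smul_apply, smul_eq_mul] at h3
  rcases mul_eq_zero.1 h3.symm with h4 | h4
  · exact hej h4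
  · rw [h4, mul_zero] at this
    exact hn this

/-! ### The product of the planes in closed form. -/

/-- `Re (x + i y) ^ 5`. -/
def reFive (x y : ℂ) : ℂ := x ^ 5 - 10 * x ^ 3 * y ^ 2 + 5 * x * y ^ 4

/-- The cosine of the `j`-th fifth of a full turn. -/
noncomputable def ct (j : ℕ) : ℝ := Real.cos (2 * Real.pi * j / 5)

/-- The sine of the `j`-th fifth of a full turn. -/
noncomputable def st (j : ℕ) : ℝ := Real.sin (2 * Real.pi * j / 5)

theorem ct_sq_add_st_sq (j : ℕ) : ct j ^ 2 + st j ^ 2 = 1 := Real.cos_sq_add_sin_sq _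

theorem ct_add_st_mul_I (j : ℕ) :
    (ct j : ℂ) + st j * Complex.I = Complex.exp (2 * Real.pi * Complex.I / (5 : ℕ)) ^ j := by
  rw [← Complex.exp_nat_mul, show (j : ℂ) * (2 * Real.pi * Complex.I / (5 : ℕ))
    = ((2 * Real.pi * j / 5 : ℝ) : ℂ) * Complex.I by push_cast; ring, Complex.exp_mul_I]
  simp only [ct, st, Complex.ofReal_cos, Complex.ofReal_sin]

theorem ct_add_st_mul_I_pow (j : ℕ) : ((ct j : ℂ) + st j * Complex.I) ^ 5 = 1 := by
  have h := (Complex.isPrimitiveRoot_exp 5 (by norm_num)).pow_eq_one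
  rw [ct_add_st_mul_I, pow_right_comm, h, one_pow]

theorem ct_st_injective {j k : ℕ} (hj : j < 5) (hk : k < 5) (hc : ct j = ct k)
    (hs : st j = st k) : j = k := by
  refine (Complex.isPrimitiveRoot_exp 5 (by norm_num)).pow_inj hj hk ?_
  rw [← ct_add_st_mul_I, ← ct_add_st_mul_I, hc, hs]

theorem ct_st_complex (j : ℕ) : (ct j : ℂ) ^ 2 + (st j : ℂ) ^ 2 = 1 := by
  exact_mod_cast ct_sq_add_st_sq j

/-- The fourth power of a fifth root of unity is its inverse, hence its conjugate; these are the
real and imaginary parts. -/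
theorem ct_st_four (j : ℕ) :
    (ct j : ℂ) ^ 4 - 6 * (ct j : ℂ) ^ 2 * (st j : ℂ) ^ 2 + (st j : ℂ) ^ 4 = ct j ∧
    4 * (ct j : ℂ) ^ 3 * st j - 4 * (ct j : ℂ) * (st j : ℂ) ^ 3 = - st j := by
  have h5 := ct_add_st_mul_I_pow j
  have h2 := ct_st_complex j
  have hI := Complex.I_sq
  generalize (ct j : ℂ) = c at *
  generalize (st j : ℂ) = s at *
  set I := Complex.I
  have hnorm : (c + s * I) * (c - s * I) = 1 := by linear_combination h2 - s ^ 2 * hI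
  have h4 : (c + s * I) ^ 4 = c - s * I := by
    linear_combination (c - s * I) * h5 - (c + s * I) ^ 4 * hnorm
  have h4' : (c - s * I) ^ 4 = c + s * I := by
    have hn5 : ((c + s * I) * (c - s * I)) ^ 5 = 1 := by rw [hnorm, one_pow]
    have h5' : (c - s * I) ^ 5 = 1 := by
      linear_combination hn5 - (c - s * I) ^ 5 * h5
    linear_combination (c + s * I) * h5' - (c - s * I) ^ 4 * hnorm
  constructor
  · linear_combination (h4 + h4') / 2 - (6 * c ^ 2 * s ^ 2 + s ^ 4 * (I ^ 2 - 1)) * hI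
  · refine mul_right_cancel₀ Complex.I_ne_zero ?_
    change _ * I = _ * I
    linear_combination (h4 - h4') / 2 - 4 * c * s ^ 3 * I * hI

theorem reFive_ct_st (j : ℕ) : reFive (ct j) (st j) = 1 := by
  obtain ⟨h1, h2⟩ := ct_st_four j
  have h3 := ct_st_complex j
  unfold reFive
  linear_combination (ct j : ℂ) * h1 - (st j : ℂ) * h2 + h3

/-- In polar coordinates this is `r⁵ (cos 5θ - T₅(z/r)) / 16` with the Chebyshev polynomial `T₅`.
The proof multiplies the conjugate pairs `j = 1, 4` and `j = 2, 3`, using the values of the cosines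
in terms of `√5`. -/
theorem prod_planes (x y z : ℂ) :
    ∏ j ∈ Finset.range 5, ((ct j : ℂ) * x + (st j : ℂ) * y - z)
      = (reFive x y - 5 * z * (x ^ 2 + y ^ 2) ^ 2 + 20 * z ^ 3 * (x ^ 2 + y ^ 2)
          - 16 * z ^ 5) / 16 := by
  have h0 : ct 0 = 1 ∧ st 0 = 0 := by simp [ct, st]
  have hc4 : ct 4 = ct 1 ∧ st 4 = - st 1 := by
    unfold ct st
    have : 2 * Real.pi * (4 : ℕ) / 5 = 2 * Real.pi - 2 * Real.pi * (1 : ℕ) / 5 := by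
      push_cast; ring
    rw [this]
    simp
  have hc3 : ct 3 = ct 2 ∧ st 3 = - st 2 := by
    unfold ct st
    have : 2 * Real.pi * (3 : ℕ) / 5 = 2 * Real.pi - 2 * Real.pi * (2 : ℕ) / 5 := by
      push_cast; ring
    rw [this]
    simp
  have h5 : √5 ^ 2 = (5 : ℝ) := Real.sq_sqrt (by norm_num)
  have hc2 : ct 2 = -(1 + √5) / 4 := by
    unfold ct
    rw [show 2 * Real.pi * (2 : ℕ) / 5 = Real.pi - Real.pi / 5 by push_cast; ring,
      Real.cos_pi_sub, Real.cos_pi_div_five]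
    ring
  have hc1 : ct 1 = (√5 - 1) / 4 := by
    unfold ct
    rw [show 2 * Real.pi * (1 : ℕ) / 5 = 2 * (Real.pi / 5) by push_cast; ring,
      Real.cos_two_mul, Real.cos_pi_div_five]
    linear_combination h5 / 8
  have h1 := ct_st_complex 1
  have h2 := ct_st_complex 2
  have h5' : (√5 : ℂ) ^ 2 = (5 : ℂ) := by exact_mod_cast h5
  simp only [Finset.prod_range_succ, Finset.prod_range_zero, h0.1, h0.2, hc4.1, hc4.2, hc3.1,
    hc3.2]
  rw [hc1] at h1 ⊢
  rw [hc2] at h2 ⊢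
  generalize st 1 = s₁ at *
  generalize st 2 = s₂ at *
  push_cast at *
  generalize (√5 : ℂ) = r at *
  generalize (s₁ : ℂ) = s₁ at *
  generalize (s₂ : ℂ) = s₂ at *
  have e1 : s₁ ^ 2 = (5 + r) / 8 := by linear_combination h1 - h5' / 16
  have e2 : s₂ ^ 2 = (5 - r) / 8 := by linear_combination h2 - h5' / 16
  have p1 : ((r - 1) / 4 * x + s₁ * y - z) * ((r - 1) / 4 * x - s₁ * y - z)
      = ((r - 1) / 4 * x - z) ^ 2 - (5 + r) / 8 * y ^ 2 := by
    linear_combination - y ^ 2 * e1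
  have p2 : (-(1 + r) / 4 * x + s₂ * y - z) * (-(1 + r) / 4 * x - s₂ * y - z)
      = (-(1 + r) / 4 * x - z) ^ 2 - (5 - r) / 8 * y ^ 2 := by
    linear_combination - y ^ 2 * e2
  have p3 : (((r - 1) / 4 * x - z) ^ 2 - (5 + r) / 8 * y ^ 2)
      * ((-(1 + r) / 4 * x - z) ^ 2 - (5 - r) / 8 * y ^ 2)
      = ((x ^ 2 - 2 * x * z - 4 * z ^ 2) ^ 2 - 10 * y ^ 2 * (x ^ 2 + 2 * x * z + 2 * z ^ 2)
        + 5 * y ^ 4) / 16 := by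
    have r2 : r ^ 2 = 5 := h5'
    have r4 : r ^ 4 = 25 := by linear_combination (r ^ 2 + 5) * r2
    ring_nf
    simp only [r2, r4]
    ring
  unfold reFive
  linear_combination (x - z) * ((r - 1) / 4 * x + s₁ * y - z) * ((r - 1) / 4 * x - s₁ * y - z) * p2
    + (x - z) * ((-(1 + r) / 4 * x - z) ^ 2 - (5 - r) / 8 * y ^ 2) * p1 + (x - z) * p3

/-- The value of the product of the six planes. -/
noncomputable def pval (x y z : ℂ) : ℂ :=
  z * (reFive x y - 5 * z * (x ^ 2 + y ^ 2) ^ 2 + 20 * z ^ 3 * (x ^ 2 + y ^ 2) - 16 * z ^ 5) / 16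

theorem eval_planes (x : Fin 4 → ℂ) : eval x planes = pval (x 0) (x 1) (x 2) := by
  have := prod_planes (x 0) (x 1) (x 2)
  simp only [ct, st] at this
  simp only [planes, map_mul, eval_X, map_prod, map_sub, map_add, eval_C, this, pval]
  ring

/-- Explicit rational coefficients make the partial derivatives and the substitution in `w`
computable. -/
theorem planes_eq : planes = C (1 / 16) * (X 2 * (X 0 ^ 5 - C 10 * X 0 ^ 3 * X 1 ^ 2
    + C 5 * X 0 * X 1 ^ 4 - C 5 * X 2 * (X 0 ^ 2 + X 1 ^ 2) ^ 2
    + C 20 * X 2 ^ 3 * (X 0 ^ 2 + X 1 ^ 2) - C 16 * X 2 ^ 5)) := by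
  refine MvPolynomial.funext fun x => ?_
  rw [eval_planes]
  simp only [pval, reFive, map_mul, map_sub, map_add, map_pow, eval_C, eval_X]
  ring

/-! ### Equations for the singular points. -/

theorem isHomogeneous_planes : planes.IsHomogeneous 6 := by
  unfold planes
  refine (isHomogeneous_X ℂ 2).mul (n := 5) ?_
  have := MvPolynomial.IsHomogeneous.prod (Finset.range 5) (fun j : ℕ =>
    (C ((Real.cos (2 * Real.pi * j / 5) : ℝ) : ℂ) * X 0
      + C ((Real.sin (2 * Real.pi * j / 5) : ℝ) : ℂ) * X 1 - X 2 : MvPolynomial (Fin 4) ℂ))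
    (fun _ => 1) fun j _ =>
      ((isHomogeneous_C_mul_X _ 0).add (isHomogeneous_C_mul_X _ 1)).sub (isHomogeneous_X ℂ 2)
  simpa using this

theorem isHomogeneous_sextic (s t u v : ℂ) : (sextic s t u v).IsHomogeneous 6 := by
  refine isHomogeneous_planes.sub (MvPolynomial.IsHomogeneous.pow (m := 2) ?_ 3)
  unfold quadric
  refine IsHomogeneous.add (IsHomogeneous.add (IsHomogeneous.add ?_ ?_) ?_) ?_
  · exact ((isHomogeneous_X_pow 0 2).add (isHomogeneous_X_pow 1 2)).C_mul s
  · exact (isHomogeneous_X_pow 2 2).C_mul t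
  · exact ((isHomogeneous_X ℂ 2).mul (isHomogeneous_X ℂ 3)).C_mul u
  · exact (isHomogeneous_X_pow 3 2).C_mul v

theorem scaleW_sextic (s t : ℂ) : scaleW Complex.I (sextic₁ s t 0) = sextic s t 0 (-1) := by
  rw [sextic₁, sextic, sextic, planes_eq]
  have hI : (C Complex.I : MvPolynomial (Fin 4) ℂ) ^ 2 = -1 := by
    rw [← map_pow, Complex.I_sq, map_neg, map_one]
  simp [scaleW, quadric, mul_pow, hI]

/-- The value of the quadric. -/
def qval (s t v x y z w : ℂ) : ℂ := s * (x ^ 2 + y ^ 2) + t * z ^ 2 + v * w ^ 2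

theorem eval_sextic (s t v : ℂ) (x : Fin 4 → ℂ) : eval x (sextic s t 0 v)
    = pval (x 0) (x 1) (x 2) - qval s t v (x 0) (x 1) (x 2) (x 3) ^ 3 := by
  simp [sextic, quadric, eval_planes, qval]

/-- The vector `(x, y, z, w)` is a singular zero of the sextic. -/
def IsSing (s t v x y z w : ℂ) : Prop :=
  pval x y z - qval s t v x y z w ^ 3 = 0 ∧
  z * (5 * (x ^ 4 - 6 * x ^ 2 * y ^ 2 + y ^ 4) + x * (-20 * z * (x ^ 2 + y ^ 2) + 40 * z ^ 3)) / 16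
    - 6 * s * x * qval s t v x y z w ^ 2 = 0 ∧
  z * (-5 * (4 * x ^ 3 * y - 4 * x * y ^ 3) + y * (-20 * z * (x ^ 2 + y ^ 2) + 40 * z ^ 3)) / 16
    - 6 * s * y * qval s t v x y z w ^ 2 = 0 ∧
  (reFive x y - 10 * z * (x ^ 2 + y ^ 2) ^ 2 + 80 * z ^ 3 * (x ^ 2 + y ^ 2) - 96 * z ^ 5) / 16
    - 6 * t * z * qval s t v x y z w ^ 2 = 0 ∧
  v * w * qval s t v x y z w ^ 2 = 0

theorem isSing_iff (s t v : ℂ) (x : Fin 4 → ℂ) :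
    (eval x (sextic s t 0 v) = 0 ∧ ∀ i, eval x (pderiv i (sextic s t 0 v)) = 0) ↔
      IsSing s t v (x 0) (x 1) (x 2) (x 3) := by
  rw [eval_sextic, IsSing]
  have h0 : eval x (pderiv 0 (sextic s t 0 v)) = x 2 * (5 * (x 0 ^ 4 - 6 * x 0 ^ 2 * x 1 ^ 2
      + x 1 ^ 4) + x 0 * (-20 * x 2 * (x 0 ^ 2 + x 1 ^ 2) + 40 * x 2 ^ 3)) / 16
      - 6 * s * x 0 * qval s t v (x 0) (x 1) (x 2) (x 3) ^ 2 := by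
    simp [sextic, planes_eq, quadric, qval, Derivation.leibniz_pow, pderiv_X]
    ring
  have h1 : eval x (pderiv 1 (sextic s t 0 v)) = x 2 * (-5 * (4 * x 0 ^ 3 * x 1
      - 4 * x 0 * x 1 ^ 3) + x 1 * (-20 * x 2 * (x 0 ^ 2 + x 1 ^ 2) + 40 * x 2 ^ 3)) / 16
      - 6 * s * x 1 * qval s t v (x 0) (x 1) (x 2) (x 3) ^ 2 := by
    simp [sextic, planes_eq, quadric, qval, Derivation.leibniz_pow, pderiv_X]
    ring
  have h2 : eval x (pderiv 2 (sextic s t 0 v)) = (reFive (x 0) (x 1)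
      - 10 * x 2 * (x 0 ^ 2 + x 1 ^ 2) ^ 2 + 80 * x 2 ^ 3 * (x 0 ^ 2 + x 1 ^ 2)
      - 96 * x 2 ^ 5) / 16 - 6 * t * x 2 * qval s t v (x 0) (x 1) (x 2) (x 3) ^ 2 := by
    simp [sextic, planes_eq, quadric, qval, reFive, Derivation.leibniz_pow, pderiv_X]
    ring
  have h3 : eval x (pderiv 3 (sextic s t 0 v))
      = -6 * (v * x 3 * qval s t v (x 0) (x 1) (x 2) (x 3) ^ 2) := by
    simp [sextic, planes_eq, quadric, qval, Derivation.leibniz_pow, pderiv_X]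
    ring
  refine and_congr_right fun _ => ⟨fun h => ?_, fun h i => ?_⟩
  · refine ⟨h0 ▸ h 0, h1 ▸ h 1, h2 ▸ h 2, ?_⟩
    have := h 3
    rw [h3] at this
    exact (mul_eq_zero.1 this).resolve_left (by norm_num)
  · fin_cases i
    · exact h0.trans h.1
    · exact h1.trans h.2.1
    · exact h2.trans h.2.2.1
    · exact h3.trans (by rw [h.2.2.2, mul_zero])

theorem IsSing.smul {s t v x y z w : ℂ} (h : IsSing s t v x y z w) (c : ℂ) :
    IsSing s t v (c * x) (c * y) (c * z) (c * w) := by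
  obtain ⟨h0, h1, h2, h3, h4⟩ := h
  simp only [IsSing, pval, qval, reFive] at *
  refine ⟨?_, ?_, ?_, ?_, ?_⟩
  · linear_combination c ^ 6 * h0
  · linear_combination c ^ 5 * h1
  · linear_combination c ^ 5 * h2
  · linear_combination c ^ 5 * h3
  · linear_combination c ^ 5 * h4

/-- The singularity equations are homogeneous, so the chosen representative may be replaced by any
other. -/
theorem mk_mem_singularPoints {s t v : ℂ} {x : Fin 4 → ℂ} {hx : x ≠ 0} :
    Projectivization.mk ℂ x hx ∈ singularPoints (sextic s t 0 v) ↔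
      IsSing s t v (x 0) (x 1) (x 2) (x 3) := by
  obtain ⟨a, ha⟩ := Projectivization.exists_smul_eq_mk_rep ℂ x hx
  rw [singularPoints, Set.mem_ofPred_eq, isSing_iff, ← ha]
  have ha0 : (a : ℂ) ≠ 0 := a.ne_zero
  constructor
  · intro h
    have := h.smul (a : ℂ)⁻¹
    simpa [Units.smul_def, ha0] using this
  · intro h
    exact h.smul (a : ℂ)

/-! ### Fivefold rotational symmetry. -/

/-- `c + i s` is a fifth root of unity on the unit circle, in terms of real-type coordinates. -/
structure IsFifthTurn (c s : ℂ) : Prop where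
  norm : c ^ 2 + s ^ 2 = 1
  re_four : c ^ 4 - 6 * c ^ 2 * s ^ 2 + s ^ 4 = c
  im_four : 4 * c ^ 3 * s - 4 * c * s ^ 3 = -s

theorem isFifthTurn_ct_st (j : ℕ) : IsFifthTurn (ct j) (st j) :=
  ⟨ct_st_complex j, (ct_st_four j).1, (ct_st_four j).2⟩

namespace IsFifthTurn

variable {c s : ℂ}

theorem neg (h : IsFifthTurn c s) : IsFifthTurn c (-s) :=
  ⟨by linear_combination h.norm, by linear_combination h.re_four,
    by linear_combination -h.im_four⟩

theorem reFive_rotate (h : IsFifthTurn c s) (x y : ℂ) :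
    reFive (c * x - s * y) (s * x + c * y) = reFive x y := by
  -- Real and imaginary parts of `(c + i s)^5 = 1`.
  have h1 : c * (c ^ 4 - 6 * c ^ 2 * s ^ 2 + s ^ 4) - s * (4 * c ^ 3 * s - 4 * c * s ^ 3) = 1 := by
    rw [h.re_four, h.im_four]; linear_combination h.norm
  have h2 : s * (c ^ 4 - 6 * c ^ 2 * s ^ 2 + s ^ 4) + c * (4 * c ^ 3 * s - 4 * c * s ^ 3) = 0 := by
    rw [h.re_four, h.im_four]; ring
  unfold reFive
  linear_combination (x ^ 5 - 10 * x ^ 3 * y ^ 2 + 5 * x * y ^ 4) * h1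
    - (y ^ 5 - 10 * y ^ 3 * x ^ 2 + 5 * y * x ^ 4) * h2

theorem sq_rotate (h : IsFifthTurn c s) (x y : ℂ) :
    (c * x - s * y) ^ 2 + (s * x + c * y) ^ 2 = x ^ 2 + y ^ 2 := by
  linear_combination (x ^ 2 + y ^ 2) * h.norm

theorem pval_rotate (h : IsFifthTurn c s) (x y z : ℂ) :
    pval (c * x - s * y) (s * x + c * y) z = pval x y z := by
  rw [pval, h.reFive_rotate, h.sq_rotate, pval]

theorem qval_rotate (h : IsFifthTurn c s) (σ t v x y z w : ℂ) :
    qval σ t v (c * x - s * y) (s * x + c * y) z w = qval σ t v x y z w := by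
  rw [qval, h.sq_rotate, qval]

/-- The `x`- and `y`-derivatives rotate like a vector: `(x + i y)^4` is multiplied by `(c + i s)^4 =
c - i s`, which is `e1` and `e2`. -/
theorem isSing_rotate (h : IsFifthTurn c s) {σ t v x y z w : ℂ} (hs : IsSing σ t v x y z w) :
    IsSing σ t v (c * x - s * y) (s * x + c * y) z w := by
  obtain ⟨h0, h1, h2, h3, h4⟩ := hs
  have e1 : (c * x - s * y) ^ 4 - 6 * (c * x - s * y) ^ 2 * (s * x + c * y) ^ 2
      + (s * x + c * y) ^ 4
      = c * (x ^ 4 - 6 * x ^ 2 * y ^ 2 + y ^ 4) + s * (4 * x ^ 3 * y - 4 * x * y ^ 3) := by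
    linear_combination (x ^ 4 - 6 * x ^ 2 * y ^ 2 + y ^ 4) * h.re_four
      - (4 * x ^ 3 * y - 4 * x * y ^ 3) * h.im_four
  have e2 : 4 * (c * x - s * y) ^ 3 * (s * x + c * y) - 4 * (c * x - s * y) * (s * x + c * y) ^ 3
      = -s * (x ^ 4 - 6 * x ^ 2 * y ^ 2 + y ^ 4) + c * (4 * x ^ 3 * y - 4 * x * y ^ 3) := by
    linear_combination (x ^ 4 - 6 * x ^ 2 * y ^ 2 + y ^ 4) * h.im_four
      + (4 * x ^ 3 * y - 4 * x * y ^ 3) * h.re_four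
  refine ⟨?_, ?_, ?_, ?_, ?_⟩
  · rw [h.pval_rotate, h.qval_rotate, h0]
  · rw [h.qval_rotate, h.sq_rotate, e1]
    linear_combination c * h1 - s * h2
  · rw [h.qval_rotate, h.sq_rotate, e2]
    linear_combination s * h1 + c * h2
  · rw [h.qval_rotate, h.sq_rotate, h.reFive_rotate, h3]
  · rw [h.qval_rotate, h4]

theorem eq_rotate_x (h : IsFifthTurn c s) (x y : ℂ) :
    x = c * (c * x + s * y) - s * (-s * x + c * y) := by
  linear_combination -x * h.norm

theorem eq_rotate_y (h : IsFifthTurn c s) (x y : ℂ) :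
    y = s * (c * x + s * y) + c * (-s * x + c * y) := by
  linear_combination -y * h.norm

theorem isSing_unrotate (h : IsFifthTurn c s) {σ t v x y z w : ℂ} (hs : IsSing σ t v x y z w) :
    IsSing σ t v (c * x + s * y) (-s * x + c * y) z w := by
  simpa using h.neg.isSing_rotate hs

end IsFifthTurn

theorem exists_turn_of_reFive_eq_zero {x y : ℂ} (h : reFive x y = 0) :
    ∃ j : Fin 5, (ct j : ℂ) * x + st j * y = 0 := by
  have hp := prod_planes x y 0
  rw [h] at hp
  have : ∏ j ∈ Finset.range 5, ((ct j : ℂ) * x + (st j : ℂ) * y - 0) = 0 := by rw [hp]; ring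
  obtain ⟨j, hj, h0⟩ := Finset.prod_eq_zero_iff.1 this
  exact ⟨⟨j, Finset.mem_range.1 hj⟩, by simpa using h0⟩

/-! ### Classification of the singular points. -/

section Classification

variable {σ v : ℂ}

/-- On `y = 0` the planes give `z (x - z)(x² - 2xz - 4z²)² / 16`; the square marks the intersection
lines of mirror-image planes. Where `q = 0`, every term containing `q` drops out. -/
theorem isSing_cusp_finite {x w : ℂ} (hx : x ^ 2 - 2 * x - 4 = 0)
    (hq : qval σ (4 * σ) v x 0 1 w = 0) : IsSing σ (4 * σ) v x 0 1 w := by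
  refine ⟨?_, ?_, ?_, ?_, ?_⟩ <;> rw [hq]
  · rw [pval, reFive]; linear_combination (x - 1) * (x ^ 2 - 2 * x - 4) * hx / 16
  · linear_combination 5 * x * (x - 2) * hx / 16
  · ring
  · rw [reFive]; linear_combination (x ^ 3 - 8 * x ^ 2 - 12 * x + 24) * hx / 16
  · ring

theorem isSing_cusp_infinite {w : ℂ} (hq : qval σ (4 * σ) v 0 1 0 w = 0) :
    IsSing σ (4 * σ) v 0 1 0 w := by
  refine ⟨?_, ?_, ?_, ?_, ?_⟩ <;> rw [hq]
  · simp [pval]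
  · ring
  · ring
  · rw [reFive]; ring
  · ring

theorem isSing_node (hσ : σ ^ 3 = 5 / 1728) {x : ℂ} (hx : x ^ 2 - 12 * x + 16 = 0) :
    IsSing σ (4 * σ) v x 0 1 0 := by
  refine ⟨?_, ?_, ?_, ?_, ?_⟩ <;> simp only [pval, qval, reFive]
  · linear_combination -(x ^ 2 - 12 * x + 16) * (5 * x ^ 2 + 12 * x + 8) / 1728 * hx
      - (x ^ 2 + 4) ^ 3 * hσ
  · linear_combination -30 * x * (x ^ 2 - 6 * x - 8) / 1728 * hx - 6 * x * (x ^ 2 + 4) ^ 2 * hσ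
  · ring
  · linear_combination (9 * x ^ 3 + 8 * x ^ 2 - 48 * x - 64) / 144 * hx
      - 24 * (x ^ 2 + 4) ^ 2 * hσ
  · ring

theorem IsSing.of_y_eq_zero (hσ : σ ^ 3 = 5 / 1728) (hv : v ≠ 0) {x z w : ℂ} (hz : z ≠ 0)
    (h : IsSing σ (4 * σ) v x 0 z w) :
    (qval σ (4 * σ) v x 0 z w = 0 ∧ x ^ 2 - 2 * x * z - 4 * z ^ 2 = 0) ∨
      (w = 0 ∧ x ^ 2 - 12 * x * z + 16 * z ^ 2 = 0) := by
  obtain ⟨h0, h1, -, -, h4⟩ := h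
  by_cases hq : qval σ (4 * σ) v x 0 z w = 0
  · refine Or.inl ⟨hq, ?_⟩
    by_contra hne
    rw [hq] at h0 h1
    have e0 : z * (x ^ 2 - 2 * x * z - 4 * z ^ 2) ^ 2 * (x - z) = 0 := by
      simp only [pval, reFive] at h0; linear_combination 16 * h0
    -- The simple factor `x - z` is excluded by the `x`-derivative, which there equals `25 x⁵ / 16`.
    have hxz : x = z := sub_eq_zero.1 ((mul_eq_zero.1 e0).resolve_left
      (mul_ne_zero hz (pow_ne_zero 2 hne)))
    subst hxz
    have : x ^ 5 = 0 := by linear_combination 16 / 25 * h1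
    exact hz (pow_eq_zero_iff (by norm_num) |>.1 this)
  · have hw : w = 0 := by
      have := (mul_eq_zero.1 h4).resolve_right (pow_ne_zero 2 hq)
      exact (mul_eq_zero.1 this).resolve_left hv
    subst hw
    refine Or.inr ⟨rfl, ?_⟩
    by_contra hne
    simp only [pval, qval, reFive] at h0 h1
    have e0 : (x ^ 2 - 12 * x * z + 16 * z ^ 2) ^ 2
        * (5 * x ^ 2 + 12 * x * z + 8 * z ^ 2) = 0 := by
      linear_combination -1728 * h0 - 1728 * (x ^ 2 + 4 * z ^ 2) ^ 3 * hσ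
    have e1 : (x ^ 2 - 12 * x * z + 16 * z ^ 2) * (x * (x ^ 2 - 6 * x * z - 8 * z ^ 2)) = 0 := by
      linear_combination -1728 / 30 * h1 - 1728 / 5 * x * (x ^ 2 + 4 * z ^ 2) ^ 2 * hσ
    -- Away from the double roots the two cofactors must vanish together, and they have no common
    -- zero with `z ≠ 0`.
    have f0 := (mul_eq_zero.1 e0).resolve_left (pow_ne_zero 2 hne)
    rcases mul_eq_zero.1 ((mul_eq_zero.1 e1).resolve_left hne) with rfl | f1
    · have : z ^ 2 = 0 := by linear_combination f0 / 8
      exact hz (pow_eq_zero_iff two_ne_zero |>.1 this)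
    · have hxz : x * (x + z) = 0 := by linear_combination (f0 + f1) / 6
      have : z ^ 2 = 0 := by
        rcases mul_eq_zero.1 hxz with rfl | hx
        · linear_combination f0 / 8
        · linear_combination -f1 + (x - 7 * z) * hx
      exact hz (pow_eq_zero_iff two_ne_zero |>.1 this)

theorem IsSing.classify (hσ : σ ^ 3 = 5 / 1728) (hv : v ≠ 0) {x y z w : ℂ}
    (h : IsSing σ (4 * σ) v x y z w) :
    ∃ (j : Fin 5) (x' y' : ℂ), x = ct j * x' - st j * y' ∧ y = st j * x' + ct j * y' ∧
      ((qval σ (4 * σ) v x' y' z w = 0 ∧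
        ((z ≠ 0 ∧ y' = 0 ∧ x' ^ 2 - 2 * x' * z - 4 * z ^ 2 = 0) ∨ (z = 0 ∧ x' = 0))) ∨
      (z ≠ 0 ∧ y' = 0 ∧ w = 0 ∧ x' ^ 2 - 12 * x' * z + 16 * z ^ 2 = 0)) := by
  by_cases hz : z = 0
  · subst hz
    have h3 : reFive x y = 0 := by linear_combination 16 * h.2.2.2.1
    obtain ⟨j, hj⟩ := exists_turn_of_reFive_eq_zero h3
    have ht := isFifthTurn_ct_st j
    refine ⟨j, _, _, ht.eq_rotate_x x y, ht.eq_rotate_y x y, Or.inl ⟨?_, Or.inr ⟨rfl, hj⟩⟩⟩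
    have h0 := (ht.isSing_unrotate h).1
    rw [pval, zero_mul, zero_div, zero_sub, neg_eq_zero] at h0
    exact pow_eq_zero_iff three_ne_zero |>.1 h0
  -- The combination `y ∂ₓ - x ∂_y` cancels all rotation-invariant terms and leaves `z · Im (x + i
  -- y)^5`.
  · have h5 : reFive y (-x) = 0 := by
      refine (mul_eq_zero.1 ?_).resolve_left hz
      unfold reFive
      linear_combination (-16 / 5 * x) * h.2.2.1 + 16 / 5 * y * h.2.1
    obtain ⟨j, hj⟩ := exists_turn_of_reFive_eq_zero h5
    have ht := isFifthTurn_ct_st j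
    have hy : -(st j : ℂ) * x + ct j * y = 0 := by linear_combination hj
    refine ⟨j, _, _, ht.eq_rotate_x x y, ht.eq_rotate_y x y, ?_⟩
    have h' := ht.isSing_unrotate h
    rw [hy] at h' ⊢
    rcases h'.of_y_eq_zero hσ hv hz with ⟨hq, hx⟩ | ⟨hw, hx⟩
    · exact Or.inl ⟨hq, Or.inl ⟨hz, rfl, hx⟩⟩
    · exact Or.inr ⟨hz, rfl, hw, hx⟩

end Classification

/-! ### Local normal forms at nodes and cusps. -/

section Germs

variable {σ v c s : ℂ}

theorem eval_sextic_unrotate (h : IsFifthTurn c s) (t : ℂ) (x : Fin 4 → ℂ) :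
    eval x (sextic σ t 0 v) = pval (c * x 0 + s * x 1) (-s * x 0 + c * x 1) (x 2)
      - qval σ t v (c * x 0 + s * x 1) (-s * x 0 + c * x 1) (x 2) (x 3) ^ 3 := by
  have h1 := h.neg.pval_rotate (x 0) (x 1) (x 2)
  have h2 := h.neg.qval_rotate σ t v (x 0) (x 1) (x 2) (x 3)
  simp only [neg_mul, sub_neg_eq_add] at h1 h2 ⊢
  rw [eval_sextic, h1, h2]

theorem insertNth_two_one (y : Fin 3 → ℂ) :
    (Fin.insertNth 2 1 y : Fin 4 → ℂ) = ![y 0, y 1, 1, y 2] := by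
  ext i; fin_cases i <;> rfl

theorem insertNth_three_one (y : Fin 3 → ℂ) :
    (Fin.insertNth 3 1 y : Fin 4 → ℂ) = ![y 0, y 1, y 2, 1] := by
  ext i; fin_cases i <;> rfl

/-- The continuous linear form on `ℂ³` with the given coefficients. -/
noncomputable def linForm (p q r : ℂ) : (Fin 3 → ℂ) →L[ℂ] ℂ :=
  p • ContinuousLinearMap.proj 0 + q • ContinuousLinearMap.proj 1 + r • ContinuousLinearMap.proj 2

theorem linForm_apply (p q r : ℂ) (y : Fin 3 → ℂ) :
    linForm p q r y = p * y 0 + q * y 1 + r * y 2 := rfl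

theorem hasFDerivAt_linForm_add (p q r d : ℂ) (a : Fin 3 → ℂ) :
    HasFDerivAt (fun y => linForm p q r y + d) (linForm p q r) a :=
  (linForm p q r).hasFDerivAt.add_const d

theorem analyticAt_of_contDiff {f : (Fin 3 → ℂ) → ℂ} (hf : ContDiff ℂ ⊤ f) (a : Fin 3 → ℂ) :
    AnalyticAt ℂ f a :=
  hf.contDiffAt.analyticAt

theorem analyticAt_linForm_add (p q r d : ℂ) (a : Fin 3 → ℂ) :
    AnalyticAt ℂ (fun y => linForm p q r y + d) a :=
  analyticAt_of_contDiff ((linForm p q r).contDiff.add contDiff_const) a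

theorem hasFDerivAt_qval (t c s : ℂ) (a : Fin 3 → ℂ) :
    HasFDerivAt (fun y : Fin 3 → ℂ =>
        qval σ t v (c * y 0 + s * y 1) (-s * y 0 + c * y 1) (y 2) 1)
      ((2 * σ * (c * a 0 + s * a 1)) • linForm c s 0
        + (2 * σ * (-s * a 0 + c * a 1)) • linForm (-s) c 0 + (2 * t * a 2) • linForm 0 0 1) a := by
  have h1 := (linForm c s 0).hasFDerivAt (x := a)
  have h2 := (linForm (-s) c 0).hasFDerivAt (x := a)
  have h3 := (linForm 0 0 1).hasFDerivAt (x := a)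
  have := ((((h1.mul h1).add (h2.mul h2)).const_mul σ).add ((h3.mul h3).const_mul t)).add_const v
  have h := this.congr_fderiv (g' := (2 * σ * (c * a 0 + s * a 1)) • linForm c s 0
        + (2 * σ * (-s * a 0 + c * a 1)) • linForm (-s) c 0 + (2 * t * a 2) • linForm 0 0 1) (by
    ext y
    simp [linForm_apply]
    ring)
  refine h.congr_of_eventuallyEq (.of_forall fun y => ?_)
  simp [qval, linForm_apply]
  ring

theorem IsFifthTurn.isAGerm_node (h : IsFifthTurn c s) (hσ : σ ^ 3 = 5 / 1728) (hv : v ≠ 0)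
    {x : ℂ} (hx : x ^ 2 - 12 * x + 16 = 0) :
    IsAGerm 1 (fun y => eval (Fin.insertNth 2 1 y : Fin 4 → ℂ) (sextic σ (4 * σ) 0 v))
      ![c * x, s * x, 0] := by
  have hσ0 : σ ≠ 0 := by rintro rfl; norm_num at hσ
  have hX : c * (c * x) + s * (s * x) = x := by linear_combination x * h.norm
  have hY : -(s * (c * x)) + c * (s * x) = 0 := by ring
  have hx1 : x - 1 ≠ 0 := fun h1 => by
    have : x = 1 := by linear_combination h1
    subst this; norm_num at hx
  -- In rotated coordinates `X, Y` the sextic is `A (X - x)² + B Y² + D w²`. Here `A` comes from the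
  -- double-root factorisation, `12 - x` being the other root; `B` collects the terms divisible by
  -- `Y²`, and `D` comes from `(Q + v w²)³ - Q³`.
  set A : (Fin 3 → ℂ) → ℂ := fun y => -((c * y 0 + s * y 1 - (12 - x)) ^ 2
      * (5 * (c * y 0 + s * y 1) ^ 2 + 12 * (c * y 0 + s * y 1) + 8) / 1728) with hA
  set B : (Fin 3 → ℂ) → ℂ := fun y => (-10 * (c * y 0 + s * y 1) ^ 3
      + 5 * (c * y 0 + s * y 1) * (-s * y 0 + c * y 1) ^ 2
      - 5 * (2 * (c * y 0 + s * y 1) ^ 2 + (-s * y 0 + c * y 1) ^ 2) + 20) / 16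
      - 5 / 1728 * (3 * ((c * y 0 + s * y 1) ^ 2 + 4) ^ 2
        + 3 * ((c * y 0 + s * y 1) ^ 2 + 4) * (-s * y 0 + c * y 1) ^ 2
        + (-s * y 0 + c * y 1) ^ 4) with hB
  set Q : (Fin 3 → ℂ) → ℂ := fun y =>
    σ * ((c * y 0 + s * y 1) ^ 2 + (-s * y 0 + c * y 1) ^ 2 + 4) with hQ
  set D : (Fin 3 → ℂ) → ℂ := fun y =>
    -(v * (3 * Q y ^ 2 + 3 * Q y * (v * y 2 ^ 2) + (v * y 2 ^ 2) ^ 2)) with hD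
  have cA : AnalyticAt ℂ A ![c * x, s * x, 0] := analyticAt_of_contDiff (by fun_prop) _
  have cB : AnalyticAt ℂ B ![c * x, s * x, 0] := analyticAt_of_contDiff (by fun_prop) _
  have cD : AnalyticAt ℂ D ![c * x, s * x, 0] := analyticAt_of_contDiff (by fun_prop) _
  have A0 : A ![c * x, s * x, 0] ≠ 0 := by
    simp only [hA, Matrix.cons_val, hX, neg_ne_zero]
    refine div_ne_zero (mul_ne_zero (pow_ne_zero 2 fun h6 => ?_) fun h6 => ?_) (by norm_num)
    · have : x = 6 := by linear_combination h6 / 2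
      subst this; norm_num at hx
    · exact hx1 (by linear_combination (h6 - 5 * hx) / 72)
  have B0 : B ![c * x, s * x, 0] ≠ 0 := by
    simp only [hB, Matrix.cons_val, hX, neg_mul, hY]
    intro h6
    have : x = 3 / 2 := by
      linear_combination -(h6 - (-5 / 576 * x ^ 2 - 35 / 48 * x - 335 / 36) * hx) / 100
    subst this; norm_num at hx
  have D0 : D ![c * x, s * x, 0] ≠ 0 := by
    simp only [hD, hQ, Matrix.cons_val, hX, neg_mul, hY, neg_ne_zero]
    refine mul_ne_zero hv fun h6 => hx1 ?_
    have : (σ * (x - 1)) ^ 2 = 0 := by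
      linear_combination (h6 - 3 * σ ^ 2 * (x ^ 2 + 12 * x - 8) * hx) / 432
    exact (mul_eq_zero.1 (pow_eq_zero_iff two_ne_zero |>.1 this)).resolve_left hσ0
  refine isAGerm_of_units (fun y => linForm c s 0 y + -x) (fun y => linForm (-s) c 0 y + 0)
    (fun y => linForm 0 0 1 y + 0) A (fun y => B y / A y) (fun y => D y / A y)
    (analyticAt_linForm_add _ _ _ _ _) (analyticAt_linForm_add _ _ _ _ _)
    (analyticAt_linForm_add _ _ _ _ _) cA (cB.div cA A0) (cD.div cA A0) A0
    (div_ne_zero B0 A0) (div_ne_zero D0 A0) ?_ ?_ ?_ (hasFDerivAt_linForm_add _ _ _ _ _)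
    (hasFDerivAt_linForm_add _ _ _ _ _) (hasFDerivAt_linForm_add _ _ _ _ _)
    ![![c, s, 0], ![-s, c, 0], ![0, 0, 1]] ?_ ?_
  · simp [linForm_apply, hX]
  · simp [linForm_apply, hY]
  · simp [linForm_apply]
  · have : (c * c + s * s) * (c * c + s * s) ≠ 0 := by
      rw [← sq c, ← sq s, h.norm]; norm_num
    convert this using 1
    simp [Matrix.det_fin_three, linForm_apply]
    ring
  · filter_upwards [cA.continuousAt.eventually_ne A0] with y hy
    rw [eval_sextic_unrotate h, insertNth_two_one]
    have : A y * ((linForm c s 0 y + -x) ^ (1 + 1) + B y / A y * (linForm (-s) c 0 y + 0) ^ 2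
        + D y / A y * (linForm 0 0 1 y + 0) ^ 2) = A y * (c * y 0 + s * y 1 - x) ^ 2
        + B y * (-s * y 0 + c * y 1) ^ 2 + D y * y 2 ^ 2 := by
      simp only [linForm_apply]
      field_simp
      ring
    rw [this]
    simp only [hA, hB, hD, hQ, Matrix.cons_val, pval, qval, reFive]
    generalize c * y 0 + s * y 1 = X
    generalize -s * y 0 + c * y 1 = Y
    generalize y 2 = w
    linear_combination -(X ^ 2 + Y ^ 2 + 4) ^ 3 * hσ + (x ^ 2 - 12 * x + 16
      - 2 * (X ^ 2 - 12 * X + 16)) * (5 * X ^ 2 + 12 * X + 8) / 1728 * hx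

theorem IsFifthTurn.isAGerm_cusp_finite (h : IsFifthTurn c s) (hσ : σ ≠ 0) {x κ : ℂ}
    (hκ : κ ≠ 0) (hx : x ^ 2 - 2 * x - 4 = 0) (hq : qval σ (4 * σ) v (κ * x) 0 κ 1 = 0) :
    IsAGerm 2 (fun y => eval (Fin.insertNth 3 1 y : Fin 4 → ℂ) (sextic σ (4 * σ) 0 v))
      ![c * (κ * x), s * (κ * x), κ] := by
  have hX : c * (c * (κ * x)) + s * (s * (κ * x)) = κ * x := by
    linear_combination κ * x * h.norm
  have hY : -(s * (c * (κ * x))) + c * (s * (κ * x)) = 0 := by ring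
  have hx1 : x - 1 ≠ 0 := fun h1 => by
    have : x = 1 := by linear_combination h1
    subst this; norm_num at hx
  -- The planes are `-(A (X - x z)² + B Y²)`, with `2 - x` the conjugate root; the cube in the
  -- normal form is that of `q` itself. The chart `w = 1` puts the point at scale `κ = 1/w`.
  set A : (Fin 3 → ℂ) → ℂ := fun y => -(y 2 * (c * y 0 + s * y 1 - y 2)
      * (c * y 0 + s * y 1 - (2 - x) * y 2) ^ 2 / 16) with hA
  set B : (Fin 3 → ℂ) → ℂ := fun y => -(y 2 * (-10 * (c * y 0 + s * y 1) ^ 3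
      + 5 * (c * y 0 + s * y 1) * (-s * y 0 + c * y 1) ^ 2
      - 5 * y 2 * (2 * (c * y 0 + s * y 1) ^ 2 + (-s * y 0 + c * y 1) ^ 2)
      + 20 * y 2 ^ 3) / 16) with hB
  have A0 : A ![c * (κ * x), s * (κ * x), κ] ≠ 0 := by
    simp only [hA, Matrix.cons_val, hX, neg_ne_zero]
    have : κ * (κ * x - κ) * (κ * x - (2 - x) * κ) ^ 2 / 16 = κ ^ 4 * (x - 1) ^ 3 / 4 := by ring
    rw [this]
    exact div_ne_zero (mul_ne_zero (pow_ne_zero 4 hκ) (pow_ne_zero 3 hx1)) (by norm_num)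
  have B0 : B ![c * (κ * x), s * (κ * x), κ] ≠ 0 := by
    simp only [hB, Matrix.cons_val, hX, neg_mul, hY, neg_ne_zero]
    intro h6
    have : κ ^ 4 * (x + 1) = 0 := by
      linear_combination -(16 * h6 - κ ^ 4 * (-10 * x - 30) * hx) / 100
    have : x = -1 := by
      linear_combination (mul_eq_zero.1 this).resolve_left (pow_ne_zero 4 hκ)
    subst this; norm_num at hx
  refine isAGerm_of_units (fun y => qval σ (4 * σ) v (c * y 0 + s * y 1) (-s * y 0 + c * y 1)
    (y 2) 1) (fun y => linForm c s (-x) y + 0)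
    (fun y => linForm (-s) c 0 y + 0) (fun _ => -1) A B
    (analyticAt_of_contDiff (by unfold qval; fun_prop) _) (analyticAt_linForm_add _ _ _ _ _)
    (analyticAt_linForm_add _ _ _ _ _) analyticAt_const
    (analyticAt_of_contDiff (by fun_prop) _) (analyticAt_of_contDiff (by fun_prop) _)
    (by norm_num) A0 B0 ?_ ?_ ?_ (hasFDerivAt_qval _ _ _ _)
    (hasFDerivAt_linForm_add _ _ _ _ _) (hasFDerivAt_linForm_add _ _ _ _ _)
    ![![c, s, 0], ![-s, c, 0], ![0, 0, 1]] ?_ ?_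
  · simpa [hX, hY] using hq
  · simp [linForm_apply, hX]; ring
  · simp [linForm_apply, hY]
  · have hn : c * c + s * s = 1 := by rw [← sq, ← sq, h.norm]
    -- The derivative of `q` along the intersection line, in direction `(x, 0, 1)`: this is
    -- transversality.
    have : 2 * σ * κ * (x ^ 2 + 4) ≠ 0 := by
      refine mul_ne_zero (by simp [hσ, hκ]) fun h6 => ?_
      have : x = -4 := by linear_combination (h6 - hx) / 2
      subst this; norm_num at hx
    convert this using 1
    simp only [Matrix.det_fin_three, Matrix.of_apply, Matrix.cons_val, linForm_apply,
      add_apply, smul_apply, smul_eq_mul, hX, neg_mul, hY]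
    simp
    linear_combination (2 * σ * κ * x ^ 2 + 8 * σ * κ) * (c * c + s * s + 1) * hn
  · refine Filter.Eventually.of_forall fun y => ?_
    rw [eval_sextic_unrotate h, insertNth_three_one]
    simp only [hA, hB, Matrix.cons_val, pval, reFive, linForm_apply]
    generalize qval _ _ _ _ _ _ _ = q
    generalize c * y 0 + s * y 1 = X
    generalize -s * y 0 + c * y 1 = Y
    generalize y 2 = z
    linear_combination z ^ 3 * (X - z) * (2 * (X ^ 2 - 2 * X * z - 4 * z ^ 2)
      - z ^ 2 * (x ^ 2 - 2 * x - 4)) / 16 * hx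

theorem IsFifthTurn.isAGerm_cusp_infinite (h : IsFifthTurn c s) (hσ : σ ≠ 0) {κ : ℂ}
    (hκ : κ ≠ 0) (hq : qval σ (4 * σ) v 0 κ 0 1 = 0) :
    IsAGerm 2 (fun y => eval (Fin.insertNth 3 1 y : Fin 4 → ℂ) (sextic σ (4 * σ) 0 v))
      ![-(s * κ), c * κ, 0] := by
  have hX : -(c * (s * κ)) + s * (c * κ) = 0 := by ring
  have hY : s * (s * κ) + c * (c * κ) = κ := by linear_combination κ * h.norm
  set U : (Fin 3 → ℂ) → ℂ := fun y => (((c * y 0 + s * y 1) ^ 2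
      - 2 * (c * y 0 + s * y 1) * y 2 - 4 * y 2 ^ 2) ^ 2
      - 10 * (-s * y 0 + c * y 1) ^ 2 * ((c * y 0 + s * y 1) ^ 2
        + 2 * (c * y 0 + s * y 1) * y 2 + 2 * y 2 ^ 2)
      + 5 * (-s * y 0 + c * y 1) ^ 4) / 64 with hU
  have U0 : U ![-(s * κ), c * κ, 0] ≠ 0 := by
    simp [hU, hX, hY, hκ]
  have cU : AnalyticAt ℂ U ![-(s * κ), c * κ, 0] := analyticAt_of_contDiff (by fun_prop) _
  -- The planes `z` and `X - z` meet here; their product becomes a difference of squares by `4 z (X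
  -- - z) = X² - (X - 2z)²`.
  refine isAGerm_of_units (fun y => qval σ (4 * σ) v (c * y 0 + s * y 1) (-s * y 0 + c * y 1)
    (y 2) 1) (fun y => linForm c s 0 y + 0)
    (fun y => linForm c s (-2) y + 0) (fun _ => -1) (fun y => -U y) U
    (analyticAt_of_contDiff (by unfold qval; fun_prop) _) (analyticAt_linForm_add _ _ _ _ _)
    (analyticAt_linForm_add _ _ _ _ _) analyticAt_const cU.neg cU
    (by norm_num) (neg_ne_zero.2 U0) U0 ?_ ?_ ?_ (hasFDerivAt_qval _ _ _ _)
    (hasFDerivAt_linForm_add _ _ _ _ _) (hasFDerivAt_linForm_add _ _ _ _ _)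
    ![![c, s, 0], ![-s, c, 0], ![0, 0, 1]] ?_ ?_
  · simpa [hX, hY] using hq
  · simp [linForm_apply, hX]
  · simp [linForm_apply, hX]
  · have hn : c * c + s * s = 1 := by rw [← sq, ← sq, h.norm]
    have : 4 * σ * κ ≠ 0 := by simp [hσ, hκ]
    convert this using 1
    simp [Matrix.det_fin_three, linForm_apply, hX, hY]
    linear_combination 4 * σ * κ * (c * c + s * s + 1) * hn
  · refine Filter.Eventually.of_forall fun y => ?_
    rw [eval_sextic_unrotate h, insertNth_three_one]
    simp only [hU, Matrix.cons_val, pval, reFive, linForm_apply]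
    generalize qval _ _ _ _ _ _ _ = q
    ring

end Germs

/-! ### Explicit coordinates of the singular points. -/

/-- The first coordinates of the unrotated cusps. -/
noncomputable def cuspX : Fin 3 → ℝ := ![1 + √5, 1 - √5, 0]

/-- The second coordinates of the unrotated cusps. -/
def cuspY : Fin 3 → ℝ := ![0, 0, 1]

/-- The third coordinates of the unrotated cusps. -/
def cuspZ : Fin 3 → ℝ := ![1, 1, 0]

/-- The absolute value of the last coordinate of the real cusps. -/
noncomputable def cuspHeight (σ : ℝ) (k : Fin 3) : ℝ :=
  √(σ * (cuspX k ^ 2 + cuspY k ^ 2 + 4 * cuspZ k ^ 2))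

/-- The two signs. -/
def sgn : Fin 2 → ℝ := ![1, -1]

/-- Coordinates of the cusps of the real sextic. -/
noncomputable def cuspCoord (σ : ℝ) (i : Fin 5 × Fin 3 × Fin 2) : Fin 4 → ℝ :=
  ![ct i.1 * cuspX i.2.1 - st i.1 * cuspY i.2.1, st i.1 * cuspX i.2.1 + ct i.1 * cuspY i.2.1,
    cuspZ i.2.1, sgn i.2.2 * cuspHeight σ i.2.1]

/-- The radii of the nodes. -/
noncomputable def nodeX : Fin 2 → ℝ := ![6 + 2 * √5, 6 - 2 * √5]

/-- Coordinates of the nodes of the real sextic. -/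
noncomputable def nodeCoord (i : Fin 5 × Fin 2) : Fin 4 → ℝ :=
  ![ct i.1 * nodeX i.2, st i.1 * nodeX i.2, 1, 0]

/-- The complex vector obtained from a real one by scaling the last coordinate by `ω`. -/
noncomputable def wScale (ω : ℂ) (c : Fin 4 → ℝ) : Fin 4 → ℂ := ![c 0, c 1, c 2, ω * c 3]

theorem wScale_ne_zero {ω : ℂ} (hω : ω ≠ 0) {c : Fin 4 → ℝ} (hc : c ≠ 0) : wScale ω c ≠ 0 := by
  refine fun h => hc (funext fun i => ?_)
  have := congrFun h i
  fin_cases i <;> simpa [wScale, hω] using this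

theorem wScale_injective {ω : ℂ} (hω : ω ≠ 0) {c d : Fin 4 → ℝ} (h : wScale ω c = wScale ω d) :
    c = d := by
  refine funext fun i => ?_
  have := congrFun h i
  fin_cases i <;> simpa [wScale, hω] using this

theorem sqrt_five_sq : √5 ^ 2 = (5 : ℝ) := Real.sq_sqrt (by norm_num)

theorem cuspX_cases (k : Fin 3) :
    (cuspX k ^ 2 - 2 * cuspX k - 4 = 0 ∧ cuspY k = 0 ∧ cuspZ k = 1) ∨
      (cuspX k = 0 ∧ cuspY k = 1 ∧ cuspZ k = 0 ∧ k = 2) := by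
  have := sqrt_five_sq
  fin_cases k
  · exact Or.inl ⟨by simp [cuspX]; linear_combination this, rfl, rfl⟩
  · exact Or.inl ⟨by simp [cuspX]; linear_combination this, rfl, rfl⟩
  · exact Or.inr ⟨rfl, rfl, rfl, rfl⟩

theorem cusp_radius_pos (k : Fin 3) : 0 < cuspX k ^ 2 + cuspY k ^ 2 := by
  rcases cuspX_cases k with ⟨h, -, -⟩ | ⟨h1, h2, -⟩
  · have : cuspX k ≠ 0 := fun h0 => by rw [h0] at h; norm_num at h
    positivity
  · rw [h1, h2]; norm_num

theorem cusp_radius_injective {k l : Fin 3}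
    (h : cuspX k ^ 2 + cuspY k ^ 2 = cuspX l ^ 2 + cuspY l ^ 2) : k = l := by
  have h5 := sqrt_five_sq
  have hpos : 2 < √5 := by rw [Real.lt_sqrt] <;> norm_num
  have hlt : √5 < 2.4 := by rw [Real.sqrt_lt] <;> norm_num
  fin_cases k <;> fin_cases l <;> simp [cuspX, cuspY] at h ⊢ <;> nlinarith

theorem cuspHeight_pos {σ : ℝ} (hσ : 0 < σ) (k : Fin 3) : 0 < cuspHeight σ k :=
  Real.sqrt_pos.2 (mul_pos hσ (add_pos_of_pos_of_nonneg (cusp_radius_pos k) (by positivity)))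

theorem cuspHeight_sq {σ : ℝ} (hσ : 0 < σ) (k : Fin 3) :
    cuspHeight σ k ^ 2 = σ * (cuspX k ^ 2 + cuspY k ^ 2 + 4 * cuspZ k ^ 2) :=
  Real.sq_sqrt (by positivity)

theorem sgn_sq (e : Fin 2) : sgn e ^ 2 = 1 := by fin_cases e <;> simp [sgn]

theorem sgn_ne_zero (e : Fin 2) : sgn e ≠ 0 := fun h => by
  have := sgn_sq e
  rw [h] at this
  norm_num at this

theorem sgn_injective {e f : Fin 2} (h : sgn e = sgn f) : e = f := by
  fin_cases e <;> fin_cases f <;> simp [sgn] at h ⊢ <;> norm_num at h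

theorem cuspCoord_ne_zero {σ : ℝ} (hσ : 0 < σ) (i : Fin 5 × Fin 3 × Fin 2) :
    cuspCoord σ i ≠ 0 := fun h => by
  have := congrFun h 3
  simp [cuspCoord, (cuspHeight_pos hσ _).ne', sgn_ne_zero] at this

theorem nodeCoord_ne_zero (i : Fin 5 × Fin 2) : nodeCoord i ≠ 0 := fun h => by
  have := congrFun h 2
  simp [nodeCoord] at this

/-- The sign matters for cusps on `z = 0`, whose coordinates are not normalised by `z = 1`. The
radius determines the orbit, and `τ = -1` is impossible because the negative of a fifth root of
unity is not one. -/
theorem cuspCoord_injective_up_to_sign {σ τ : ℝ} (hσ : 0 < σ) (hτ : τ ^ 2 = 1)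
    {i j : Fin 5 × Fin 3 × Fin 2} (h : cuspCoord σ i = τ • cuspCoord σ j) :
    τ = 1 ∧ i = j := by
  obtain ⟨m, k, e⟩ := i
  obtain ⟨n, l, f⟩ := j
  have h0 := congrFun h 0
  have h1 := congrFun h 1
  have h3 := congrFun h 3
  simp only [cuspCoord, Matrix.cons_val, Pi.smul_apply, smul_eq_mul] at h0 h1 h3
  have hm := ct_sq_add_st_sq m
  have hn := ct_sq_add_st_sq n
  obtain rfl : k = l := cusp_radius_injective (by
    have e0 := congrArg (· ^ 2) h0
    have e1 := congrArg (· ^ 2) h1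
    linear_combination e0 + e1 - (cuspX k ^ 2 + cuspY k ^ 2) * hm
      + τ ^ 2 * (cuspX l ^ 2 + cuspY l ^ 2) * hn + (cuspX l ^ 2 + cuspY l ^ 2) * hτ)
  have hr := (cusp_radius_pos k).ne'
  have hc : ct m = τ * ct n := mul_right_cancel₀ hr (by
    linear_combination cuspX k * h0 + cuspY k * h1)
  have hs : st m = τ * st n := mul_right_cancel₀ hr (by
    linear_combination cuspX k * h1 - cuspY k * h0)
  have hτ1 : τ = 1 := by
    have em := reFive_ct_st m
    have en := reFive_ct_st n
    rw [hc, hs] at em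
    have hτ' : (τ : ℂ) ^ 2 = 1 := by exact_mod_cast hτ
    have : (τ : ℂ) = 1 := by
      rw [← em]
      unfold reFive at en ⊢
      push_cast
      have : (τ : ℂ) ^ 5 = τ := by linear_combination τ * ((τ : ℂ) ^ 2 + 1) * hτ'
      linear_combination -(τ : ℂ) ^ 5 * en - this
    exact_mod_cast this
  subst hτ1
  simp only [one_mul] at hc hs h3
  have hmn : m = n := Fin.ext (ct_st_injective m.2 n.2 hc hs)
  have hef : e = f := sgn_injective (mul_right_cancel₀ (cuspHeight_pos hσ k).ne' h3)
  exact ⟨rfl, by rw [hmn, hef]⟩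

/-! ### Counting the points. -/

section Points

variable {σ : ℝ} {ω v : ℂ}

/-- The cusps of the sextic. -/
noncomputable def cuspPoint (hσ : 0 < σ) (hω : ω ≠ 0) (i : Fin 5 × Fin 3 × Fin 2) : P3 :=
  Projectivization.mk ℂ (wScale ω (cuspCoord σ i)) (wScale_ne_zero hω (cuspCoord_ne_zero hσ i))

/-- The nodes of the sextic. -/
noncomputable def nodePoint (hω : ω ≠ 0) (i : Fin 5 × Fin 2) : P3 :=
  Projectivization.mk ℂ (wScale ω (nodeCoord i)) (wScale_ne_zero hω (nodeCoord_ne_zero i))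

theorem cuspPoint_injective (hσ : 0 < σ) (hω : ω ≠ 0) :
    Function.Injective (cuspPoint hσ hω) := by
  rintro ⟨m, k, e⟩ ⟨n, l, f⟩ h
  obtain ⟨a, ha⟩ := (Projectivization.mk_eq_mk_iff' ℂ _ _ _ _).1 h
  have h2 := congrFun ha 2
  have h3 := congrFun ha 3
  simp only [wScale, cuspCoord, Matrix.cons_val, Pi.smul_apply, smul_eq_mul] at h2 h3
  obtain ⟨τ, hτ, rfl⟩ : ∃ τ : ℝ, τ ^ 2 = 1 ∧ a = τ := by
    rcases cuspX_cases k with ⟨-, -, hk⟩ | ⟨-, -, hk, hk'⟩ <;>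
    rcases cuspX_cases l with ⟨-, -, hl⟩ | ⟨-, -, hl, hl'⟩ <;> rw [hk, hl] at h2
    · exact ⟨1, by norm_num, by simpa using h2⟩
    · simp at h2
    · exact absurd (by simpa using h2 : a = 0) fun h0 => by
        rw [h0, zero_smul] at ha
        exact wScale_ne_zero hω (cuspCoord_ne_zero hσ _) ha.symm
    -- Both points lie on `z = 0`, where the scalar is read off from the last coordinates, equal up
    -- to sign and nonzero.
    · subst hk' hl'
      refine ⟨sgn e * sgn f, by rw [mul_pow, sgn_sq, sgn_sq, one_mul], ?_⟩
      have hh : (cuspHeight σ 2 : ℂ) ≠ 0 := by exact_mod_cast (cuspHeight_pos hσ 2).ne'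
      have hf : (sgn f : ℂ) ^ 2 = 1 := by exact_mod_cast sgn_sq f
      refine mul_right_cancel₀ (mul_ne_zero hω hh) ?_
      push_cast at h3 ⊢
      linear_combination (sgn f : ℂ) * h3 - a * ω * cuspHeight σ 2 * hf
  refine (cuspCoord_injective_up_to_sign hσ hτ (wScale_injective hω (ha.symm.trans ?_))).2
  ext i
  fin_cases i <;> simp [wScale]
  ring

theorem nodePoint_injective (hω : ω ≠ 0) : Function.Injective (nodePoint hω) := by
  rintro ⟨m, e⟩ ⟨n, f⟩ h
  obtain ⟨a, ha⟩ := (Projectivization.mk_eq_mk_iff' ℂ _ _ _ _).1 h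
  have h2 := congrFun ha 2
  obtain rfl : a = 1 := by simpa [wScale, nodeCoord] using h2
  rw [one_smul] at ha
  have hc := wScale_injective hω ha
  have h0 := congrFun hc 0
  have h1 := congrFun hc 1
  simp only [nodeCoord, Matrix.cons_val] at h0 h1
  have hpos : 2 < √5 := by rw [Real.lt_sqrt] <;> norm_num
  have hlt : √5 < 2.4 := by rw [Real.sqrt_lt] <;> norm_num
  have hX : ∀ e, 0 < nodeX e := fun e => by
    fin_cases e <;> simp [nodeX] <;> linarith
  have hef : nodeX e = nodeX f := by
    have hm := ct_sq_add_st_sq m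
    have hn := ct_sq_add_st_sq n
    refine (pow_left_inj₀ (hX e).le (hX f).le two_ne_zero).1 ?_
    have e0 := congrArg (· ^ 2) h0
    have e1 := congrArg (· ^ 2) h1
    linear_combination -e0 - e1 - nodeX e ^ 2 * hm + nodeX f ^ 2 * hn
  rw [hef] at h0 h1
  have hmn : m = n := Fin.ext (ct_st_injective m.2 n.2
    (mul_right_cancel₀ (hX f).ne' h0.symm) (mul_right_cancel₀ (hX f).ne' h1.symm))
  have : e = f := by
    fin_cases e <;> fin_cases f <;> simp [nodeX] at hef ⊢ <;> linarith
  rw [hmn, this]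

theorem mk_eq_of_eq_smul {x y : Fin 4 → ℂ} (hx : x ≠ 0) (hy : y ≠ 0) (a : ℂ) (h : x = a • y) :
    Projectivization.mk ℂ x hx = Projectivization.mk ℂ y hy :=
  (Projectivization.mk_eq_mk_iff' ℂ _ _ _ _).2 ⟨a, h.symm⟩

theorem qval_cusp (hσ : 0 < σ) (hv : v * ω ^ 2 = -1) (k : Fin 3) (e : Fin 2) :
    qval σ (4 * σ) v (cuspX k) (cuspY k) (cuspZ k) (ω * (sgn e * cuspHeight σ k)) = 0 := by
  have h1 : (cuspHeight σ k : ℂ) ^ 2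
      = σ * ((cuspX k : ℂ) ^ 2 + (cuspY k : ℂ) ^ 2 + 4 * (cuspZ k : ℂ) ^ 2) := by
    exact_mod_cast cuspHeight_sq hσ k
  have h2 : (sgn e : ℂ) ^ 2 = 1 := by exact_mod_cast sgn_sq e
  unfold qval
  linear_combination (sgn e * cuspHeight σ k : ℂ) ^ 2 * hv - (cuspHeight σ k : ℂ) ^ 2 * h2 - h1

theorem cuspPoint_mem_singularPoints (hσ : 0 < σ) (hω : ω ≠ 0) (hv : v * ω ^ 2 = -1)
    (i : Fin 5 × Fin 3 × Fin 2) :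
    cuspPoint hσ hω i ∈ singularPoints (sextic σ (4 * σ) 0 v) := by
  obtain ⟨m, k, e⟩ := i
  rw [cuspPoint, mk_mem_singularPoints]
  have hq := qval_cusp hσ hv k e
  have : IsSing σ (4 * σ) v (cuspX k) (cuspY k) (cuspZ k) (ω * (sgn e * cuspHeight σ k)) := by
    rcases cuspX_cases k with ⟨hX, hY, hZ⟩ | ⟨hX, hY, hZ, -⟩
    · rw [hY, hZ] at hq ⊢
      rw [Complex.ofReal_zero, Complex.ofReal_one] at hq ⊢
      exact isSing_cusp_finite (by exact_mod_cast hX) hq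
    · rw [hX, hY, hZ] at hq ⊢
      rw [Complex.ofReal_zero, Complex.ofReal_one] at hq ⊢
      exact isSing_cusp_infinite hq
  simpa [wScale, cuspCoord] using (isFifthTurn_ct_st m).isSing_rotate this

theorem nodeX_eq (e : Fin 2) : (nodeX e : ℂ) ^ 2 - 12 * nodeX e + 16 = 0 := by
  have h5 := sqrt_five_sq
  have : nodeX e ^ 2 - 12 * nodeX e + 16 = 0 := by
    fin_cases e <;> simp [nodeX] <;> linear_combination 4 * h5
  exact_mod_cast this

theorem nodePoint_mem_singularPoints (hσ : (σ : ℂ) ^ 3 = 5 / 1728) (hω : ω ≠ 0)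
    (i : Fin 5 × Fin 2) : nodePoint hω i ∈ singularPoints (sextic σ (4 * σ) 0 v) := by
  rw [nodePoint, mk_mem_singularPoints]
  simpa [wScale, nodeCoord] using
    (isFifthTurn_ct_st i.1).isSing_rotate (isSing_node (v := v) hσ (nodeX_eq i.2))

theorem isASingularity_nodePoint (hσ : (σ : ℂ) ^ 3 = 5 / 1728) (hω : ω ≠ 0) (hv : v ≠ 0)
    (i : Fin 5 × Fin 2) : IsASingularity 1 (sextic σ (4 * σ) 0 v) (nodePoint hω i) := by
  refine ⟨2, _, ?_, (isFifthTurn_ct_st i.1).isAGerm_node hσ hv (nodeX_eq i.2)⟩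
  refine mk_eq_of_eq_smul _ _ 1 ?_
  rw [insertNth_two_one]
  ext l
  fin_cases l <;> simp [wScale, nodeCoord]

theorem isASingularity_cuspPoint (hσ : 0 < σ) (hω : ω ≠ 0) (hv : v * ω ^ 2 = -1)
    (i : Fin 5 × Fin 3 × Fin 2) :
    IsASingularity 2 (sextic σ (4 * σ) 0 v) (cuspPoint hσ hω i) := by
  obtain ⟨m, k, e⟩ := i
  have hq := qval_cusp hσ hv k e
  have hσ0 : (σ : ℂ) ≠ 0 := by exact_mod_cast hσ.ne'
  set W : ℂ := ω * (sgn e * cuspHeight σ k) with hW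
  have hW0 : W ≠ 0 := by
    have h1 : (cuspHeight σ k : ℂ) ≠ 0 := by exact_mod_cast (cuspHeight_pos hσ k).ne'
    have h2 : (sgn e : ℂ) ≠ 0 := by exact_mod_cast sgn_ne_zero e
    exact mul_ne_zero hω (mul_ne_zero h2 h1)
  have hq' : qval σ (4 * σ) v (W⁻¹ * cuspX k) (W⁻¹ * cuspY k) (W⁻¹ * cuspZ k) 1 = 0 := by
    have : (1 : ℂ) = W⁻¹ * W := (inv_mul_cancel₀ hW0).symm
    rw [this]
    unfold qval at hq ⊢
    linear_combination (W⁻¹) ^ 2 * hq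
  rcases cuspX_cases k with ⟨hX, hY, hZ⟩ | ⟨hX, hY, hZ, -⟩
  · rw [hY, hZ, Complex.ofReal_zero, Complex.ofReal_one, mul_zero, mul_one] at hq'
    refine ⟨3, _, ?_, (isFifthTurn_ct_st m).isAGerm_cusp_finite hσ0 (inv_ne_zero hW0)
      (by exact_mod_cast hX) hq'⟩
    refine mk_eq_of_eq_smul _ _ W ?_
    rw [insertNth_three_one]
    ext l
    fin_cases l <;> simp [wScale, cuspCoord, hY, hZ, hW0, ← hW] <;> field_simp
  · rw [hX, hY, hZ, Complex.ofReal_zero, Complex.ofReal_one, mul_zero, mul_one] at hq'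
    refine ⟨3, _, ?_, (isFifthTurn_ct_st m).isAGerm_cusp_infinite hσ0 (inv_ne_zero hW0) hq'⟩
    refine mk_eq_of_eq_smul _ _ W ?_
    rw [insertNth_three_one]
    ext l
    fin_cases l <;> simp [wScale, cuspCoord, hX, hY, hZ, ← hW] <;> field_simp

/-- Once the intersection line is known, `q = 0` fixes the square of the last coordinate, leaving
the choice of sign. -/
theorem eq_cuspPoint (hσ : 0 < σ) (hω : ω ≠ 0) (hv : v * ω ^ 2 = -1) {x : Fin 4 → ℂ}
    (hx : x ≠ 0) {m : Fin 5} {k : Fin 3} {a : ℂ}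
    (h0 : x 0 = ct m * (a * cuspX k) - st m * (a * cuspY k))
    (h1 : x 1 = st m * (a * cuspX k) + ct m * (a * cuspY k)) (h2 : x 2 = a * cuspZ k)
    (hq : qval σ (4 * σ) v (a * cuspX k) (a * cuspY k) (a * cuspZ k) (x 3) = 0) :
    ∃ i, Projectivization.mk ℂ x hx = cuspPoint hσ hω i := by
  have hh : (cuspHeight σ k : ℂ) ^ 2
      = σ * ((cuspX k : ℂ) ^ 2 + (cuspY k : ℂ) ^ 2 + 4 * (cuspZ k : ℂ) ^ 2) := by
    exact_mod_cast cuspHeight_sq hσ k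
  obtain ⟨e, he⟩ : ∃ e : Fin 2, x 3 = a * (ω * (sgn e * cuspHeight σ k)) := by
    have : x 3 ^ 2 = (a * (ω * cuspHeight σ k)) ^ 2 := by
      unfold qval at hq
      linear_combination x 3 ^ 2 * hv - ω ^ 2 * hq - a ^ 2 * ω ^ 2 * hh
    rcases sq_eq_sq_iff_eq_or_eq_neg.1 this with h | h
    · exact ⟨0, by rw [h]; simp [sgn]⟩
    · exact ⟨1, by rw [h]; simp [sgn]⟩
  refine ⟨(m, k, e), mk_eq_of_eq_smul _ _ a ?_⟩
  ext l
  fin_cases l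
  · simp [wScale, cuspCoord, h0]; ring
  · simp [wScale, cuspCoord, h1]; ring
  · simp [wScale, cuspCoord, h2]
  · simp [wScale, cuspCoord, he]

theorem singularPoints_subset (hσ : 0 < σ) (hσ3 : (σ : ℂ) ^ 3 = 5 / 1728) (hω : ω ≠ 0)
    (hv : v * ω ^ 2 = -1) {P : P3} (hP : P ∈ singularPoints (sextic σ (4 * σ) 0 v)) :
    (∃ i, P = cuspPoint hσ hω i) ∨ ∃ i, P = nodePoint hω i := by
  induction P using Projectivization.ind with | h x hx => ?_
  rw [mk_mem_singularPoints] at hP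
  have hv0 : v ≠ 0 := by rintro rfl; simp at hv
  have h5 : (√5 : ℂ) ^ 2 = 5 := by exact_mod_cast sqrt_five_sq
  obtain ⟨m, x', y', h0, h1, ⟨hq, ⟨hz, rfl, hX⟩ | ⟨hz, rfl⟩⟩ | ⟨hz, rfl, hw, hX⟩⟩ :=
    hP.classify hσ3 hv0
  · left
    have : (x' - x 2 * (1 + √5)) * (x' - x 2 * (1 - √5)) = 0 := by
      linear_combination hX - x 2 ^ 2 * h5
    obtain ⟨k, hk, hY, hZ⟩ : ∃ k, x' = x 2 * cuspX k ∧ cuspY k = 0 ∧ cuspZ k = 1 := by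
      rcases mul_eq_zero.1 this with h | h
      · exact ⟨0, by simp [cuspX]; linear_combination h, rfl, rfl⟩
      · exact ⟨1, by simp [cuspX]; linear_combination h, rfl, rfl⟩
    refine eq_cuspPoint hσ hω hv hx (m := m) (k := k) (a := x 2) ?_ ?_ ?_ ?_
    · simp [h0, hk, hY]
    · simp [h1, hk, hY]
    · simp [hZ]
    · simpa [← hk, hY, hZ] using hq
  · left
    refine eq_cuspPoint hσ hω hv hx (m := m) (k := 2) (a := y') ?_ ?_ ?_ ?_
    · simp [h0, cuspX, cuspY]
    · simp [h1, cuspX, cuspY]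
    · simp [hz, cuspZ]
    · simpa [cuspX, cuspY, cuspZ, hz] using hq
  · right
    have : (x' - x 2 * (6 + 2 * √5)) * (x' - x 2 * (6 - 2 * √5)) = 0 := by
      linear_combination hX - 4 * x 2 ^ 2 * h5
    obtain ⟨e, he⟩ : ∃ e, x' = x 2 * nodeX e := by
      rcases mul_eq_zero.1 this with h | h
      · exact ⟨0, by simp [nodeX]; linear_combination h⟩
      · exact ⟨1, by simp [nodeX]; linear_combination h⟩
    refine ⟨(m, e), mk_eq_of_eq_smul _ _ (x 2) ?_⟩
    ext l
    fin_cases l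
    · simp [wScale, nodeCoord, h0, he]; ring
    · simp [wScale, nodeCoord, h1, he]; ring
    · simp [wScale, nodeCoord]
    · simp [wScale, nodeCoord, hw]

theorem hasExactlyCuspsNodes_sextic (hσ : 0 < σ) (hσ3 : (σ : ℂ) ^ 3 = 5 / 1728) (hω : ω ≠ 0)
    (hv : v * ω ^ 2 = -1) : HasExactlyCuspsNodes (sextic σ (4 * σ) 0 v) 30 10 := by
  have hv0 : v ≠ 0 := by rintro rfl; simp at hv
  have hF := isHomogeneous_sextic σ (4 * σ) 0 v
  have hcusp : {P ∈ singularPoints (sextic σ (4 * σ) 0 v) |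
      IsASingularity 2 (sextic σ (4 * σ) 0 v) P} = Set.range (cuspPoint hσ hω) := by
    ext P
    constructor
    · rintro ⟨hP, h2⟩
      rcases singularPoints_subset hσ hσ3 hω hv hP with ⟨i, rfl⟩ | ⟨i, rfl⟩
      · exact ⟨i, rfl⟩
      · exact ((isASingularity_nodePoint hσ3 hω hv0 i).not_cusp_of_node hF h2).elim
    · rintro ⟨i, rfl⟩
      exact ⟨cuspPoint_mem_singularPoints hσ hω hv i, isASingularity_cuspPoint hσ hω hv i⟩
  have hnode : {P ∈ singularPoints (sextic σ (4 * σ) 0 v) |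
      IsASingularity 1 (sextic σ (4 * σ) 0 v) P} = Set.range (nodePoint hω) := by
    ext P
    constructor
    · rintro ⟨hP, h1⟩
      rcases singularPoints_subset hσ hσ3 hω hv hP with ⟨i, rfl⟩ | ⟨i, rfl⟩
      · exact (h1.not_cusp_of_node hF (isASingularity_cuspPoint hσ hω hv i)).elim
      · exact ⟨i, rfl⟩
    · rintro ⟨i, rfl⟩
      exact ⟨nodePoint_mem_singularPoints hσ3 hω i, isASingularity_nodePoint hσ3 hω hv0 i⟩
  refine ⟨?_, ?_, ?_, ?_, fun P hP => ?_⟩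
  · rw [hcusp]; exact Set.finite_range _
  · rw [hcusp, ← Set.image_univ, Set.ncard_image_of_injective _ (cuspPoint_injective hσ hω),
      Set.ncard_univ]
    simp
  · rw [hnode]; exact Set.finite_range _
  · rw [hnode, ← Set.image_univ, Set.ncard_image_of_injective _ (nodePoint_injective hω),
      Set.ncard_univ]
    simp
  · rcases singularPoints_subset hσ hσ3 hω hv hP with ⟨i, rfl⟩ | ⟨i, rfl⟩
    · exact Or.inl (isASingularity_cuspPoint hσ hω hv i)
    · exact Or.inr (isASingularity_nodePoint hσ3 hω hv0 i)

theorem isRealPoint_mk_wScale_one {c : Fin 4 → ℝ} (h : wScale 1 c ≠ 0) :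
    IsRealPoint (Projectivization.mk ℂ (wScale 1 c) h) := by
  have hc : wScale 1 c = fun i => (c i : ℂ) := by
    ext i; fin_cases i <;> simp [wScale]
  exact ⟨c, hc ▸ h, mk_eq_of_eq_smul _ _ 1 (by rw [hc, one_smul])⟩

end Points

end CuspSextic

theorem theorem2 (s₀ t₀ : ℝ) (hs : s₀ = (5 : ℝ) ^ ((1 : ℝ) / 3) / 12) (ht : t₀ = 4 * s₀) :
    (CuspSextic.sextic₁ s₀ t₀ 0).IsHomogeneous 6 ∧
    CuspSextic.HasExactlyCuspsNodes (CuspSextic.sextic₁ s₀ t₀ 0) 30 10 ∧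
    CuspSextic.scaleW Complex.I (CuspSextic.sextic₁ s₀ t₀ 0) =
      CuspSextic.sextic s₀ t₀ 0 (-1) ∧
    CuspSextic.HasExactlyCuspsNodes (CuspSextic.sextic s₀ t₀ 0 (-1)) 30 10 ∧
    ∀ P ∈ CuspSextic.singularPoints (CuspSextic.sextic s₀ t₀ 0 (-1)),
      CuspSextic.IsRealPoint P := by
  have hpos : 0 < s₀ := by rw [hs]; positivity
  have hcube : s₀ ^ 3 = 5 / 1728 := by
    rw [hs, div_pow, ← Real.rpow_natCast, ← Real.rpow_mul (by norm_num)]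
    norm_num
  have hcube' : (s₀ : ℂ) ^ 3 = 5 / 1728 := by
    rw [← Complex.ofReal_pow, hcube]; norm_num
  have ht' : (t₀ : ℂ) = 4 * s₀ := by rw [ht]; push_cast; rfl
  rw [ht']
  -- The two cases are `(v, ω) = (1, i)` and `(-1, 1)`; in the second no scaling occurs and all
  -- coordinates are real.
  have hv : (1 : ℂ) * Complex.I ^ 2 = -1 := by simp
  have hv' : (-1 : ℂ) * 1 ^ 2 = -1 := by norm_num
  refine ⟨CuspSextic.isHomogeneous_sextic _ _ _ _,
    CuspSextic.hasExactlyCuspsNodes_sextic hpos hcube' Complex.I_ne_zero hv,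
    CuspSextic.scaleW_sextic _ _,
    CuspSextic.hasExactlyCuspsNodes_sextic hpos hcube' one_ne_zero hv', fun P hP => ?_⟩
  rcases CuspSextic.singularPoints_subset hpos hcube' one_ne_zero hv' hP with ⟨i, rfl⟩ | ⟨i, rfl⟩
  · exact CuspSextic.isRealPoint_mk_wScale_one _
  · exact CuspSextic.isRealPoint_mk_wScale_one _
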